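/- **Setting.** Let $\mathbf{R}^N=\mathbf{R}^{N_1}\times\dots\times\mathbf{R}^{N_n}$ carry the standard inner product; write $x^{(i)}\in\mathbf{R}^{N_i}$ for the $i$-th block of $x$ and $U_i t$ for the vector whose $i$-th block is $t$ and whose other blocks are $0$. Each $\mathbf{R}^{N_i}$ carries a norm $\|\cdot\|_{(i)}$ with conjugate norm $\|t\|_{(i)}^*=\max_{\|s\|_{(i)}\le 1}\langle s,t\rangle$, and $\|x\|_w=(\sum_i w_i\|x^{(i)}\|_{(i)}^2)^{1/2}$ for $w\in\mathbf{R}^n_{>0}$. Consider minimizing $F=f+\Omega$ over $\mathbf{R}^N$, where: - $f=\sum_{J\in\mathcal{J}}f_J$ is differentiable, $\mathcal{J}$ is a collection of subsets of $\{1,\dots,n\}$, each $f_J:\mathbf{R}^N\to\mathbf{R}$ is convex and depends on the blocks $x^{(i)}$, $i\in J$, only, and there are constants $L_1,\dots,L_n>0$ with $\|(\nabla f(x+U_it)-\nabla f(x))^{(i)}\|_{(i)}^*\le L_i\|t\|_{(i)}$ for all $x$, $i$, $t$; - $\Omega(x)=\sum_{i=1}^n\Omega_i(x^{(i)})$ with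 $\Omega_i:\mathbf{R}^{N_i}\to\mathbf{R}\cup\{+\infty\}$ convex and closed; - $F^*:=\inf F$ is finite. A function $\phi:\mathbf{R}^N\to\mathbf{R}\cup\{+\infty\}$ is strongly convex with respect to $\|\cdot\|_w$ with parameter $\mu\ge 0$ if $\phi(y)\ge\phi(x)+\langle g,y-x\rangle+\frac{\mu}{2}\|y-x\|_w^2$ for all $x,y\in\operatorname{dom}\phi$ and every subgradient $g$ of $\phi$ at $x$. **Algorithm.** The blocks $\{1,\dots,n\}$ are partitioned into $C$ disjoint sets $P^{(1)},\dots,P^{(C)}$ of equal size $s=n/C$, and $1\le\tau\le s$. In iteration $k$, each computer $c$ draws a set $Z_k^{(c)}$ uniformly at random among the subsets of $P^{(c)}$ of size $\tau$, all these draws (over all $k$ and $c$) being independent. With $Z_k=\bigcup_c Z_k^{(c)}$, the iterates are $x_{k+1}=x_k+\sum_{i\in Z_k}U_ih^{(i)}(x_k)$, where $$h^{(i)}(x)\in\arg\min_{t\in\mathbf{R}^{N_i}}\ \langle(\nabla f(x))^{(i)},t\rangle+\frac{\beta w_i}{2}\|t\|_{(i)}^2+\Omega_i(x^{(i)}+t),$$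 with $w_i=L_i$, $\xi=\max\{|P^{(c)}\cap J| : 1\le c\le C,\ J\in\mathcal{J}\}$ and $$\beta=1+\frac{(\xi-1)(\tau-1)}{\max\{1,s-1\}}+(C-1)\frac{\xi\tau}{s}.$$ **Theorem.** Suppose in addition that $f$ and $\Omega$ are strongly convex with respect to $\|\cdot\|_w$ with parameters $\mu_f\ge0$ and $\mu_\Omega\ge0$, respectively, where $\mu_f+\mu_\Omega>0$. Let $x_0\in\mathbf{R}^N$ with $F(x_0)<+\infty$, let $0<\rho<1$ and $0<\epsilon<F(x_0)-F^*$, and let the integer $K$ satisfy $$K\ \ge\ \frac{n}{C\tau}\cdot\frac{\beta+\mu_\Omega}{\mu_f+\mu_\Omega}\cdot\log\left(\frac{F(x_0)-F^*}{\epsilon\rho}\right).$$ Then $\mathbf{Prob}(F(x_K)-F^*\le\epsilon)\ge 1-\rho$. -/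

import Mathlib

open scoped BigOperators
open MeasureTheory ProbabilityTheory

namespace DBCD

noncomputable section

/-- The block `ℝ^{N_i}` with its standard Euclidean inner product. -/
abbrev Block {n : ℕ} (N : Fin n → ℕ) (i : Fin n) : Type := EuclideanSpace ℝ (Fin (N i))

/-- `ℝ^N`, `N = N_1 + ⋯ + N_n`, written block by block, with its standard inner product.
The block `x^{(i)}` of `x` is `x i`. -/
abbrev BlockSpace {n : ℕ} (N : Fin n → ℕ) : Type := PiLp 2 (fun i : Fin n => Block N i)

/-- The vector `U_i t`, whose block `i` is `t` and whose other blocks are zero. -/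
def embed {n : ℕ} {N : Fin n → ℕ} (i : Fin n) (t : Block N i) : BlockSpace N :=
  WithLp.toLp 2 (Pi.single i t)

/-- The conjugate norm `‖t‖* = max {⟨s, t⟩ : ‖s‖ ≤ 1}` of a norm `p` on a block. -/
def conjNorm {d : ℕ} (p : Seminorm ℝ (EuclideanSpace ℝ (Fin d)))
    (t : EuclideanSpace ℝ (Fin d)) : ℝ :=
  sSup ((fun s => inner ℝ s t) '' {s | p s ≤ 1})

/-- The weighted norm `‖x‖_w = (∑ i, w_i ‖x^{(i)}‖_{(i)}^2)^{1/2}`. -/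
def wNorm {n : ℕ} {N : Fin n → ℕ} (nrm : (i : Fin n) → Seminorm ℝ (Block N i))
    (w : Fin n → ℝ) (x : BlockSpace N) : ℝ :=
  √(∑ i, w i * (nrm i (x i)) ^ 2)

/-- The assumptions on the smooth part: `f = ∑_{J ∈ 𝒥} f_J` with `f_J` convex and depending on
the blocks in `J` only, and `f` differentiable with block Lipschitz gradient with constants
`L_i > 0`. -/
structure SmoothPart {n : ℕ} {N : Fin n → ℕ} (nrm : (i : Fin n) → Seminorm ℝ (Block N i))
    (f : BlockSpace N → ℝ) (𝒥 : Finset (Finset (Fin n)))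
    (fJ : Finset (Fin n) → BlockSpace N → ℝ) (L : Fin n → ℝ) : Prop where
  separable : ∀ x, f x = ∑ J ∈ 𝒥, fJ J x
  dependsOn : ∀ J ∈ 𝒥, ∀ x y : BlockSpace N, (∀ i ∈ J, x i = y i) → fJ J x = fJ J y
  convex : ∀ J ∈ 𝒥, ConvexOn ℝ Set.univ (fJ J)
  differentiable : Differentiable ℝ f
  lipschitz_pos : ∀ i, 0 < L i
  lipschitz : ∀ (x : BlockSpace N) (i : Fin n) (t : Block N i),
    conjNorm (nrm i) (gradient f (x + embed i t) i - gradient f x i) ≤ L i * nrm i t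

/-- The epigraph of an extended real valued function. -/
def epigraph {E : Type*} (φ : E → EReal) : Set (E × ℝ) := {p | φ p.1 ≤ (p.2 : EReal)}

/-- The assumptions on the regularizer `Ω(x) = ∑ i, Ω_i(x^{(i)})`: every `Ω_i` takes values in
`ℝ ∪ {+∞}` and is convex and closed. -/
structure Regularizer {n : ℕ} {N : Fin n → ℕ} (Om : (i : Fin n) → Block N i → EReal) :
    Prop where
  ne_bot : ∀ i t, Om i t ≠ ⊥
  convex : ∀ i, Convex ℝ (epigraph (Om i))
  closed : ∀ i, IsClosed (epigraph (Om i))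

/-- The separable function `Ω(x) = ∑ i, Ω_i(x^{(i)})`. -/
def separableSum {n : ℕ} {N : Fin n → ℕ} (Om : (i : Fin n) → Block N i → EReal)
    (x : BlockSpace N) : EReal :=
  ∑ i, Om i (x i)

/-- The objective `F = f + Ω`. -/
def objective {n : ℕ} {N : Fin n → ℕ} (f : BlockSpace N → ℝ)
    (Om : (i : Fin n) → Block N i → EReal) (x : BlockSpace N) : EReal :=
  (f x : EReal) + separableSum Om x

/-- `g` is a subgradient of `φ` at `x`. -/
def IsSubgradient {n : ℕ} {N : Fin n → ℕ} (φ : BlockSpace N → EReal) (x g : BlockSpace N) :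
    Prop :=
  ∀ y, φ x + ((inner ℝ g (y - x) : ℝ) : EReal) ≤ φ y

/-- `φ` (with values in `ℝ ∪ {+∞}`) is strongly convex with respect to the norm `p` with
convexity parameter `μ ≥ 0`. -/
def StronglyConvexWith {n : ℕ} {N : Fin n → ℕ} (p : BlockSpace N → ℝ)
    (φ : BlockSpace N → EReal) (μ : ℝ) : Prop :=
  0 ≤ μ ∧ ∀ x y, φ x ≠ ⊤ → φ y ≠ ⊤ → ∀ g, IsSubgradient φ x g →
    φ x + ((inner ℝ g (y - x) + μ / 2 * p (y - x) ^ 2 : ℝ) : EReal) ≤ φ y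

/-- A balanced partition of the `n` blocks into `C` groups of size `s`. -/
structure BalancedPartition {n C : ℕ} (P : Fin C → Finset (Fin n)) (s : ℕ) : Prop where
  cover : ∀ i, ∃ c, i ∈ P c
  disjoint : ∀ c c', c ≠ c' → Disjoint (P c) (P c')
  card : ∀ c, (P c).card = s

/-- `Z k c` is the random set of blocks chosen by computer `c` in iteration `k`: it is uniformly
distributed on the subsets of `P c` with `τ` elements, and all these choices (over all iterations
and all computers) are independent. -/
structure DistributedSampling {Ω' : Type*} [MeasurableSpace Ω'] (Pr : Measure Ω') {n C : ℕ}
    (P : Fin C → Finset (Fin n)) (τ : ℕ) (Z : ℕ → Fin C → Ω' → Finset (Fin n)) : Prop where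
  measurable : ∀ k c S, MeasurableSet {ω | Z k c ω = S}
  uniform : ∀ k c, ∀ S ∈ (P c).powersetCard τ,
    Pr.real {ω | Z k c ω = S} = 1 / ((P c).powersetCard τ).card
  indep : iIndepFun (m := fun _ : ℕ × Fin C => (⊤ : MeasurableSpace (Finset (Fin n))))
    (fun q : ℕ × Fin C => Z q.1 q.2) Pr

/-- `ξ = max {|P^{(c)} ∩ J| : c, J ∈ 𝒥}`. -/
def overlap {n C : ℕ} (P : Fin C → Finset (Fin n)) (𝒥 : Finset (Finset (Fin n))) : ℕ :=
  (Finset.univ ×ˢ 𝒥).sup fun q : Fin C × Finset (Fin n) => (P q.1 ∩ q.2).card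

/-- `β = 1 + (ξ - 1)(τ - 1) / max {1, s - 1} + (C - 1) ξ τ / s`. -/
def stepParam (C s τ ξ : ℕ) : ℝ :=
  1 + ((ξ : ℝ) - 1) * ((τ : ℝ) - 1) / max 1 ((s : ℝ) - 1)
    + ((C : ℝ) - 1) * ((ξ : ℝ) * (τ : ℝ) / (s : ℝ))

/-- `h` is an update map of the method: for all `x` and `i`, the block `h^{(i)}(x)` minimizes
`⟨∇_i f(x), t⟩ + (β w_i / 2) ‖t‖_{(i)}^2 + Ω_i(x^{(i)} + t)` over `t ∈ ℝ^{N_i}`. -/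
def IsUpdateMap {n : ℕ} {N : Fin n → ℕ} (nrm : (i : Fin n) → Seminorm ℝ (Block N i))
    (f : BlockSpace N → ℝ) (Om : (i : Fin n) → Block N i → EReal) (β : ℝ) (w : Fin n → ℝ)
    (h : BlockSpace N → BlockSpace N) : Prop :=
  ∀ x i, IsMinOn (fun t : Block N i =>
    ((inner ℝ (gradient f x i) t + β * w i / 2 * (nrm i t) ^ 2 : ℝ) : EReal) + Om i (x i + t))
    Set.univ (h x i)

/-- The iterates of the distributed block coordinate descent method with update map `h`, started
at `x₀`, when computer `c` chooses the blocks `Z k c` in iteration `k`. -/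
def iterate {n C : ℕ} {N : Fin n → ℕ} (h : BlockSpace N → BlockSpace N) (x₀ : BlockSpace N)
    (Z : ℕ → Fin C → Finset (Fin n)) : ℕ → BlockSpace N
  | 0 => x₀
  | k + 1 => iterate h x₀ Z k +
      ∑ c, ∑ i ∈ Z k c, embed i (h (iterate h x₀ Z k) i)

end

end DBCD

open DBCD

/-! Each iteration contracts the expected gap `F(x_k) - F*` by the factor `1 - (τ/s) * l`, where `l
= (μf + μΩ) / (β + μΩ)`. Since `1 - r ≤ exp (-r)`, the expected gap after `K` steps is at most `ε *
ρ`, and Markov's inequality gives the probability bound.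

The contraction rests on an expected separable overapproximation (`SmoothPart.sum_samples_le`):
averaged over the samples `S`, the value of `f` after updating the blocks in `S` is at most `f x +
(τ/s) (⟨∇f x, h⟩ + (β/2) ‖h‖_w²)`. Each `J` is padded to a set with exactly `ξ` elements per class,
and Jensen is applied to `f_J` over the sampled part of that set. By permutation symmetry the
resulting averages depend only on the class counts of the padded set, so the `f_J` can be summed
back to `f`, now moved along a single block, where the Lipschitz bound applies. The quadratic term
carries the size of the sampled part, whose mean given that the block is sampled is exactly `β`
(`sum_samples_card_inter_eq`).

The update minimizes this model over full steps, so it can be compared with the step `l (y - x)`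
towards a nearly optimal `y`; for this `l` the quadratic terms cancel (`sum_samples_objective_le`).
The comparison needs strong convexity of `Ω` along segments, while the hypothesis only concerns
points that have a subgradient. Such points are dense in the domain (`exists_isSubgradient_near`),
and lower semicontinuity passes to the limit. -/

namespace DBCD

/-! ### Counting for the uniform sampling: symmetry and moments. -/

section Sampling

open Finset

variable {ι κ : Type*} [Fintype ι] [DecidableEq ι] [Fintype κ] [DecidableEq κ]

set_option linter.unusedSectionVars false

/-- The sets having exactly `τ` elements in each fibre of `cl`. -/
def samples (cl : ι → κ) (τ : ℕ) : Finset (Finset ι) :=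
  univ.filter fun S => ∀ c, #{i ∈ S | cl i = c} = τ

theorem mem_samples {cl : ι → κ} {τ : ℕ} {S : Finset ι} :
    S ∈ samples cl τ ↔ ∀ c, #{i ∈ S | cl i = c} = τ := by
  simp [samples]

theorem map_perm_mem_samples {cl : ι → κ} {τ : ℕ} {S : Finset ι} (σ : Equiv.Perm ι)
    (hσ : ∀ i, cl (σ i) = cl i) (hS : S ∈ samples cl τ) :
    S.map σ.toEmbedding ∈ samples cl τ := by
  rw [mem_samples] at hS ⊢
  intro c
  rw [← hS c, filter_map, card_map]
  congr 1
  ext i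
  simp [hσ]

/-- The symmetry that drives the counting: relabelling within classes permutes the samples. -/
theorem sum_samples_map_perm {M : Type*} [AddCommMonoid M] {cl : ι → κ} {τ : ℕ}
    (σ : Equiv.Perm ι) (hσ : ∀ i, cl (σ i) = cl i) (g : Finset ι → M) :
    ∑ S ∈ samples cl τ, g (S.map σ.toEmbedding) = ∑ S ∈ samples cl τ, g S := by
  refine sum_bij' (fun S _ => S.map σ.toEmbedding) (fun S _ => S.map σ.symm.toEmbedding)
    (fun S hS => map_perm_mem_samples σ hσ hS)
    (fun S hS => map_perm_mem_samples σ.symm (fun i => ?_) hS) ?_ ?_ ?_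
  · rw [← hσ (σ.symm i), Equiv.apply_symm_apply]
  · intro S _
    ext i; simp
  · intro S _
    ext i; simp
  · intro S _
    rfl

/-- Equal class counts make the cells (class, membership in `A`) and (class, membership in `B`)
equinumerous, so a class-preserving permutation `σ` carries `A` to `B`. Composing with the
transposition of `σ i` and `i`, which share a class and both lie in `B`, fixes `i`. -/
theorem exists_perm_map_eq {cl : ι → κ} {A B : Finset ι} {i : ι} (hA : i ∈ A) (hB : i ∈ B)
    (hAB : ∀ c, #{j ∈ A | cl j = c} = #{j ∈ B | cl j = c}) :
    ∃ σ : Equiv.Perm ι, (∀ j, cl (σ j) = cl j) ∧ σ i = i ∧ A.map σ.toEmbedding = B := by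
  have key : ∀ q : κ × Prop, Nonempty ({j // (cl j, j ∈ A) = q} ≃ {j // (cl j, j ∈ B) = q}) := by
    rintro ⟨c, p⟩
    have hc : #{j ∈ univ | cl j = c ∧ j ∈ A} = #{j ∈ univ | cl j = c ∧ j ∈ B} := by
      convert hAB c using 2 <;> · ext j; simp [and_comm]
    have hc' : #{j ∈ univ | cl j = c ∧ j ∉ A} = #{j ∈ univ | cl j = c ∧ j ∉ B} := by
      have e (D : Finset ι) : #{j ∈ univ | cl j = c ∧ j ∈ D} + #{j ∈ univ | cl j = c ∧ j ∉ D}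
          = #{j ∈ univ | cl j = c} := by
        rw [← filter_filter, ← filter_filter, card_filter_add_card_filter_not]
      have := e A
      have := e B
      omega
    classical
    rw [← Fintype.card_eq, Fintype.card_subtype, Fintype.card_subtype]
    by_cases hp : p
    · simp only [Prod.mk.injEq, eq_iff_iff, hp, iff_true]
      exact hc
    · simp only [Prod.mk.injEq, eq_iff_iff, hp, iff_false]
      exact hc'
  let σ : Equiv.Perm ι := Equiv.ofFiberEquiv fun q => (key q).some
  have hσ (j : ι) : (cl (σ j), σ j ∈ B) = (cl j, j ∈ A) :=
    Equiv.ofFiberEquiv_map (fun q => (key q).some) j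
  have h1 (j : ι) : cl (σ j) = cl j := congrArg Prod.fst (hσ j)
  have h2 (j : ι) : σ j ∈ B ↔ j ∈ A := by
    have := congrArg Prod.snd (hσ j)
    simpa using this
  have h3 (j : ι) : cl (Equiv.swap (σ i) i j) = cl j := by
    rw [Equiv.swap_apply_def]
    split_ifs with h h'
    · rw [h, h1]
    · rw [h', h1]
    · rfl
  have h4 (j : ι) : Equiv.swap (σ i) i j ∈ B ↔ j ∈ B := by
    rw [Equiv.swap_apply_def]
    split_ifs with h h'
    · simp [h, hB, h2, hA]
    · simp [h', hB, h2, hA]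
    · rfl
  refine ⟨σ.trans (Equiv.swap (σ i) i), fun j => by simp [h3, h1], by simp, ?_⟩
  apply eq_of_subset_of_card_le
  · intro j hj
    obtain ⟨k, hk, rfl⟩ := mem_map.1 hj
    simpa [h4, h2] using hk
  · rw [card_map, card_eq_sum_card_fiberwise (f := cl) (t := univ) (by simp),
      card_eq_sum_card_fiberwise (f := cl) (t := univ) (by simp)]
    exact (sum_congr rfl fun c _ => (hAB c).symm).le

/-- Reindexing by a class-preserving permutation that fixes `i`. This later replaces a set depending
on `J` by one depending on `i` alone. -/
theorem sum_samples_card_inter {M : Type*} [AddCommMonoid M] {cl : ι → κ} {τ : ℕ}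
    {A B : Finset ι} {i : ι} (hA : i ∈ A) (hB : i ∈ B)
    (hAB : ∀ c, #{j ∈ A | cl j = c} = #{j ∈ B | cl j = c}) (g : ℕ → M) :
    ∑ S ∈ samples cl τ with i ∈ S, g #(S ∩ A) = ∑ S ∈ samples cl τ with i ∈ S, g #(S ∩ B) := by
  obtain ⟨σ, h1, h2, rfl⟩ := exists_perm_map_eq hA hB hAB
  rw [sum_filter, sum_filter, ← sum_samples_map_perm (cl := cl) σ h1
    (fun S => if i ∈ S then g #(S ∩ A.map σ.toEmbedding) else 0)]
  refine sum_congr rfl fun S _ => ?_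
  have e : i ∈ S.map σ.toEmbedding ↔ i ∈ S := by
    have := mem_map' σ.toEmbedding (a := i) (s := S)
    rwa [Equiv.toEmbedding_apply, h2] at this
  simp only [← map_inter, card_map, e]

theorem card_samples_pair_eq {cl : ι → κ} {τ : ℕ} {i j k : ι} (hj : i ≠ j) (hk : i ≠ k)
    (h : cl j = cl k) :
    #{S ∈ samples cl τ | i ∈ S ∧ j ∈ S} = #{S ∈ samples cl τ | i ∈ S ∧ k ∈ S} := by
  simp only [card_filter]
  have hsw (l : ι) : cl (Equiv.swap j k l) = cl l := by
    rw [Equiv.swap_apply_def]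
    split_ifs with h1 h2
    · rw [h1, h]
    · rw [h2, h]
    · rfl
  rw [← sum_samples_map_perm (Equiv.swap j k) hsw]
  refine sum_congr rfl fun S _ => ?_
  have e1 : i ∈ S.map (Equiv.swap j k).toEmbedding ↔ i ∈ S := by
    conv_lhs => rw [← Equiv.swap_apply_of_ne_of_ne hj hk]
    exact mem_map' (Equiv.swap j k).toEmbedding
  have e2 : j ∈ S.map (Equiv.swap j k).toEmbedding ↔ k ∈ S := by
    have := mem_map' (Equiv.swap j k).toEmbedding (a := k) (s := S)
    rwa [Equiv.toEmbedding_apply, Equiv.swap_apply_right] at this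
  simp only [e1, e2]

theorem card_samples_mem_eq {cl : ι → κ} {τ : ℕ} {j k : ι} (h : cl j = cl k) :
    #{S ∈ samples cl τ | j ∈ S} = #{S ∈ samples cl τ | k ∈ S} := by
  simp only [card_filter]
  have hsw (l : ι) : cl (Equiv.swap j k l) = cl l := by
    rw [Equiv.swap_apply_def]
    split_ifs with h1 h2
    · rw [h1, h]
    · rw [h2, h]
    · rfl
  rw [← sum_samples_map_perm (Equiv.swap j k) hsw]
  refine sum_congr rfl fun S _ => ?_
  have e2 : j ∈ S.map (Equiv.swap j k).toEmbedding ↔ k ∈ S := by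
    have := mem_map' (Equiv.swap j k).toEmbedding (a := k) (s := S)
    rwa [Equiv.toEmbedding_apply, Equiv.swap_apply_right] at this
  simp only [e2]

/-- Double counting of pairs `(S, j)` with `j ∈ S` in the class of `i`: by symmetry all `s`
candidates `j` lie in equally many samples. -/
theorem card_samples_mem {cl : ι → κ} {s τ : ℕ} (hs : ∀ c, #{i | cl i = c} = s) (i : ι) :
    s * #{S ∈ samples cl τ | i ∈ S} = τ * #(samples cl τ) := by
  have h1 : ∑ j with cl j = cl i, #{S ∈ samples cl τ | j ∈ S}
      = s * #{S ∈ samples cl τ | i ∈ S} := by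
    rw [sum_congr rfl fun j hj => card_samples_mem_eq (mem_filter.1 hj).2, sum_const, hs,
      smul_eq_mul]
  rw [← h1]
  simp only [card_filter]
  rw [sum_comm, mul_comm, ← smul_eq_mul, ← sum_const]
  refine sum_congr rfl fun S hS => ?_
  rw [← mem_samples.1 hS (cl i), ← card_filter, filter_filter]
  congr 1
  ext j
  simp [and_comm]

theorem cast_card_samples_mem {cl : ι → κ} {s τ : ℕ} (hs0 : 0 < s)
    (hs : ∀ c, #{i | cl i = c} = s) (i : ι) :
    (#{S ∈ samples cl τ | i ∈ S} : ℝ) = τ / s * #(samples cl τ) := by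
  have h : (s : ℝ) * #{S ∈ samples cl τ | i ∈ S} = τ * #(samples cl τ) := by
    exact_mod_cast card_samples_mem (τ := τ) hs i
  have : (0 : ℝ) < s := by exact_mod_cast hs0
  field_simp
  linarith

theorem sum_card_samples_pair {cl : ι → κ} {τ : ℕ} (i : ι) (c : κ) :
    ∑ j with cl j = c, #{S ∈ samples cl τ | i ∈ S ∧ j ∈ S}
      = τ * #{S ∈ samples cl τ | i ∈ S} := by
  simp only [← filter_filter, card_filter _ (filter _ _)]
  rw [sum_comm]
  rw [sum_congr rfl (g := fun _ => τ), sum_const, smul_eq_mul, mul_comm]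
  intro S hS
  have hS' := mem_samples.1 (mem_filter.1 hS).1 c
  rw [← hS', ← card_filter, filter_filter]
  congr 1
  ext j
  simp [and_comm]

theorem card_samples_pair_of_ne {cl : ι → κ} {s τ : ℕ} (hs : ∀ c, #{i | cl i = c} = s) {i j : ι}
    (h : cl i ≠ cl j) :
    s * #{S ∈ samples cl τ | i ∈ S ∧ j ∈ S} = τ * #{S ∈ samples cl τ | i ∈ S} := by
  rw [← sum_card_samples_pair i (cl j), sum_congr rfl fun k hk => card_samples_pair_eq
    (k := j) ?_ (fun e => h (e ▸ rfl)) (mem_filter.1 hk).2, sum_const, hs, smul_eq_mul]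
  rintro rfl
  exact h (mem_filter.1 hk).2

/-- Double counting again: the candidate `j = i` accounts for the separate summand, and the other `s
- 1` share the rest equally. Keeping that summand on the left avoids a truncated `τ - 1`. -/
theorem card_samples_pair_of_eq {cl : ι → κ} {s τ : ℕ} (hs : ∀ c, #{i | cl i = c} = s) {i j : ι}
    (hij : i ≠ j) (h : cl i = cl j) :
    (s - 1) * #{S ∈ samples cl τ | i ∈ S ∧ j ∈ S}
      + #{S ∈ samples cl τ | i ∈ S} = τ * #{S ∈ samples cl τ | i ∈ S} := by
  rw [← sum_card_samples_pair i (cl i), ← add_sum_erase _ _ (a := i) (by simp), add_comm,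
    sum_congr rfl fun k hk => card_samples_pair_eq
    (k := j) ?_ hij ?_, sum_const, smul_eq_mul, card_erase_of_mem (by simp), hs]
  · simp
  · exact (ne_of_mem_erase hk).symm
  · rw [← h]; exact (mem_filter.1 (mem_of_mem_erase hk)).2

/-- The first moment of `#(S ∩ A)` over the samples `S` containing `i ∈ A`. -/
theorem sum_samples_card_inter_eq {cl : ι → κ} {s τ ξ : ℕ} (hs : ∀ c, #{i | cl i = c} = s)
    {A : Finset ι} {i : ι} (hi : i ∈ A) (hA : ∀ c, #{j ∈ A | cl j = c} = ξ) :
    ∑ S ∈ samples cl τ with i ∈ S, (#(S ∩ A) : ℝ) =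
      (#{S ∈ samples cl τ | i ∈ S} : ℝ) * stepParam (Fintype.card κ) s τ ξ := by
  set m : ℝ := (#{S ∈ samples cl τ | i ∈ S} : ℝ) with hm
  have hξs : ξ ≤ s := by
    rw [← hA (cl i), ← hs (cl i)]
    exact card_le_card (filter_subset_filter _ (subset_univ _))
  have hξ1 : 1 ≤ ξ := by
    rw [← hA (cl i)]
    exact card_pos.2 ⟨i, by simp [hi]⟩
  have hs0 : (0 : ℝ) < s := by exact_mod_cast lt_of_lt_of_le hξ1 hξs
  have h1 : ∑ S ∈ samples cl τ with i ∈ S, (#(S ∩ A) : ℝ)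
      = ∑ j ∈ A, (#{S ∈ samples cl τ | i ∈ S ∧ j ∈ S} : ℝ) := by
    have : ∀ S : Finset ι, (#(S ∩ A) : ℝ) = ∑ j ∈ A, if j ∈ S then 1 else 0 := by
      intro S
      rw [sum_ite, sum_const, sum_const_zero]
      simp [inter_comm S A, filter_mem_eq_inter]
    simp only [this]
    rw [sum_comm]
    refine sum_congr rfl fun j _ => ?_
    rw [← filter_filter, card_filter]
    push_cast
    rfl
  have h2 : ∀ c, c ≠ cl i → ∑ j ∈ A with cl j = c, (#{S ∈ samples cl τ | i ∈ S ∧ j ∈ S} : ℝ)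
      = ξ * (τ / s * m) := by
    intro c hc
    rw [← hA c, ← nsmul_eq_mul, ← sum_const]
    refine sum_congr rfl fun j hj => ?_
    have := card_samples_pair_of_ne (τ := τ) hs (i := i) (j := j)
      (by rw [(mem_filter.1 hj).2]; exact hc.symm)
    have : (s : ℝ) * #{S ∈ samples cl τ | i ∈ S ∧ j ∈ S} = τ * m := by rw [hm]; exact_mod_cast this
    field_simp
    linarith
  have h3 : ∑ j ∈ A with cl j = cl i, (#{S ∈ samples cl τ | i ∈ S ∧ j ∈ S} : ℝ)
      = m + (ξ - 1) * ((τ - 1) / max 1 ((s : ℝ) - 1) * m) := by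
    rw [← add_sum_erase _ _ (a := i) (by simp [hi])]
    congr 1
    · simp [hm]
    · have hc : (#({j ∈ A | cl j = cl i}.erase i) : ℝ) = ξ - 1 := by
        rw [card_erase_of_mem (by simp [hi]), hA, Nat.cast_sub hξ1, Nat.cast_one]
      rw [← hc, ← nsmul_eq_mul, ← sum_const]
      refine sum_congr rfl fun j hj => ?_
      have hji := ne_of_mem_erase hj
      have hcl := (mem_filter.1 (mem_of_mem_erase hj)).2
      have := card_samples_pair_of_eq (τ := τ) hs hji.symm hcl.symm
      -- A second element `j` of the class exists here, so the maximum is `s - 1`; for `s = 1` the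
      -- sum is empty.
      have hs2 : 2 ≤ s := by
        rw [← hs (cl i)]
        exact one_lt_card.2 ⟨i, by simp, j, by simp [hcl], hji.symm⟩
      have hs2' : (1 : ℝ) ≤ (s : ℝ) - 1 := by
        have : (2 : ℝ) ≤ s := by exact_mod_cast hs2
        linarith
      have : ((s : ℝ) - 1) * #{S ∈ samples cl τ | i ∈ S ∧ j ∈ S} + m = τ * m := by
        rw [hm, ← Nat.cast_one, ← Nat.cast_sub (by omega)]
        exact_mod_cast this
      rw [max_eq_right hs2']
      field_simp
      linarith
  rw [h1, ← sum_fiberwise_of_maps_to (g := cl) (t := univ) (by simp),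
    ← add_sum_erase _ _ (mem_univ (cl i)), h3,
    sum_congr rfl fun c hc => h2 c (ne_of_mem_erase hc), sum_const,
    card_erase_of_mem (mem_univ _), card_univ, nsmul_eq_mul,
    Nat.cast_sub (Fintype.card_pos_iff.2 ⟨cl i⟩)]
  simp only [stepParam]
  push_cast
  ring

end Sampling

end DBCD

namespace DBCD

/-! ### Norms on a block and the conjugate norm inequality. -/

section ConjNorm

variable {d : ℕ}

theorem continuous_seminorm {E : Type*} [NormedAddCommGroup E] [NormedSpace ℝ E]
    [FiniteDimensional ℝ E] (p : Seminorm ℝ E) : Continuous p :=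
  continuousOn_univ.1 (p.convexOn.continuousOn isOpen_univ)

/-- By compactness, `p` attains a positive minimum on the Euclidean unit sphere. -/
theorem exists_pos_mul_norm_le {E : Type*} [NormedAddCommGroup E] [NormedSpace ℝ E]
    [FiniteDimensional ℝ E] (p : Seminorm ℝ E) (hp : ∀ t, p t = 0 → t = 0) :
    ∃ a : ℝ, 0 < a ∧ ∀ t, a * ‖t‖ ≤ p t := by
  have : ProperSpace E := FiniteDimensional.proper_real E
  rcases (Metric.sphere (0 : E) 1).eq_empty_or_nonempty with h | h
  · refine ⟨1, one_pos, fun t => ?_⟩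
    have ht : t = 0 := by
      by_contra ht
      have : ‖t‖⁻¹ • t ∈ Metric.sphere (0 : E) 1 := by
        simp [norm_smul, ht]
      rw [h] at this
      exact this
    simp [ht]
  · obtain ⟨u, hu, hmin⟩ := (isCompact_sphere (0 : E) 1).exists_isMinOn h
      (continuous_seminorm p).continuousOn
    have hu0 : u ≠ 0 := by
      rintro rfl
      simp at hu
    refine ⟨p u, lt_of_le_of_ne (apply_nonneg p u) fun e => hu0 (hp u e.symm), fun t => ?_⟩
    rcases eq_or_ne t 0 with rfl | ht
    · simp
    · have hm : ‖t‖⁻¹ • t ∈ Metric.sphere (0 : E) 1 := by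
        simp [norm_smul, ht]
      have h1 : p u ≤ p (‖t‖⁻¹ • t) := hmin hm
      have ht' : 0 < ‖t‖ := norm_pos_iff.2 ht
      rw [map_smul_eq_mul, norm_inv, norm_norm, inv_mul_eq_div, le_div_iff₀ ht'] at h1
      exact h1

theorem inner_le_conjNorm_mul (p : Seminorm ℝ (EuclideanSpace ℝ (Fin d)))
    (hp : ∀ t, p t = 0 → t = 0) (s t : EuclideanSpace ℝ (Fin d)) :
    inner ℝ s t ≤ conjNorm p t * p s := by
  obtain ⟨a, ha, hap⟩ := exists_pos_mul_norm_le p hp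
  -- Boundedness is essential: otherwise the `sSup` in `conjNorm` would be the default value `0`.
  have hbdd : BddAbove ((fun s => inner ℝ s t) '' {s | p s ≤ 1}) := by
    refine ⟨a⁻¹ * ‖t‖, ?_⟩
    rintro _ ⟨u, hu, rfl⟩
    refine (real_inner_le_norm u t).trans (mul_le_mul_of_nonneg_right ?_ (norm_nonneg _))
    rw [inv_eq_one_div, le_div_iff₀' ha]
    exact (hap u).trans hu
  rcases eq_or_ne s 0 with rfl | hs
  · simp
  · have hps : 0 < p s := lt_of_le_of_ne (apply_nonneg p s) fun e => hs (hp s e.symm)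
    have : inner ℝ ((p s)⁻¹ • s) t ≤ conjNorm p t := by
      refine le_csSup hbdd ⟨(p s)⁻¹ • s, ?_, rfl⟩
      simp [map_smul_eq_mul, abs_of_pos hps, hps.ne']
    rw [inner_smul_left, RCLike.conj_to_real, inv_mul_eq_div, div_le_iff₀ hps] at this
    exact this

end ConjNorm

/-! ### Block vectors, single-block quadratic bounds, Jensen and padding. -/

section Blocks

variable {n : ℕ} {N : Fin n → ℕ}

@[simp] theorem embed_apply_same (i : Fin n) (t : Block N i) : embed i t i = t := by
  simp [embed]

theorem embed_apply_of_ne {i j : Fin n} (h : j ≠ i) (t : Block N i) : embed i t j = 0 := by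
  simp [embed, h]

theorem smul_embed (r : ℝ) (i : Fin n) (t : Block N i) : r • embed i t = embed i (r • t) := by
  ext j : 1
  rcases eq_or_ne j i with rfl | h
  · simp
  · simp [embed_apply_of_ne h]

theorem inner_embed (g : BlockSpace N) (i : Fin n) (t : Block N i) :
    inner ℝ g (embed i t) = inner ℝ (g i) t := by
  rw [PiLp.inner_apply, Finset.sum_eq_single i]
  · simp
  · intro j _ hj
    simp [embed_apply_of_ne hj]
  · simp

theorem sum_embed_apply (S : Finset (Fin n)) (h : BlockSpace N) (j : Fin n) :
    (∑ i ∈ S, embed i (h i)) j = if j ∈ S then h j else 0 := by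
  rw [WithLp.ofLp_sum, Finset.sum_apply]
  split_ifs with hj
  · rw [Finset.sum_eq_single_of_mem j hj fun i _ hi => embed_apply_of_ne hi.symm _]
    simp
  · exact Finset.sum_eq_zero fun i hi => embed_apply_of_ne (by rintro rfl; exact hj hi) _

theorem wNorm_sq (nrm : (i : Fin n) → Seminorm ℝ (Block N i)) {w : Fin n → ℝ}
    (hw : ∀ i, 0 < w i) (x : BlockSpace N) :
    wNorm nrm w x ^ 2 = ∑ i, w i * (nrm i (x i)) ^ 2 :=
  Real.sq_sqrt (Finset.sum_nonneg fun i _ => mul_nonneg (hw i).le (sq_nonneg _))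

theorem hasDerivAt_line {f : BlockSpace N → ℝ} (hf : Differentiable ℝ f) (x v : BlockSpace N)
    (r : ℝ) :
    HasDerivAt (fun r : ℝ => f (x + r • v)) (inner ℝ (gradient f (x + r • v)) v) r := by
  have h1 := (hf (x + r • v)).hasGradientAt.hasFDerivAt
  have h2 : HasDerivAt (fun r : ℝ => x + r • v) v r := by
    simpa using ((hasDerivAt_id r).smul_const v).const_add x
  exact (h1.comp_hasDerivAt r h2).congr_deriv (InnerProductSpace.toDual_apply_apply ..)

/-- A function whose partial gradient in block `i` is Lipschitz is majorized by a quadratic along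
that block. -/
theorem SmoothPart.le_quadratic {nrm : (i : Fin n) → Seminorm ℝ (Block N i)}
    (hnrm : ∀ i t, nrm i t = 0 → t = 0)
    {f : BlockSpace N → ℝ} {𝒥 : Finset (Finset (Fin n))}
    {fJ : Finset (Fin n) → BlockSpace N → ℝ} {L : Fin n → ℝ} (hf : SmoothPart nrm f 𝒥 fJ L)
    (x : BlockSpace N) (i : Fin n) (t : Block N i) :
    f (x + embed i t) ≤ f x + inner ℝ (gradient f x i) t + L i / 2 * (nrm i t) ^ 2 := by
  -- The gap between `f` along the block and its quadratic majorant. The Lipschitz bound makes its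
  -- derivative nonpositive for `r > 0`, and `g 1 ≤ g 0` is the claim.
  let g : ℝ → ℝ := fun r => f (x + r • embed i t) -
    (r * inner ℝ (gradient f x i) t + r ^ 2 * (L i / 2 * (nrm i t) ^ 2))
  have hg (r : ℝ) : HasDerivAt g (inner ℝ (gradient f (x + r • embed i t)) (embed i t) -
      (inner ℝ (gradient f x i) t + 2 * r * (L i / 2 * (nrm i t) ^ 2))) r := by
    refine (hasDerivAt_line hf.differentiable x (embed i t) r).sub (HasDerivAt.add ?_ ?_)
    · simpa using (hasDerivAt_id r).mul_const (inner ℝ (gradient f x i) t)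
    · simpa using (hasDerivAt_pow 2 r).mul_const (L i / 2 * (nrm i t) ^ 2)
  have hanti : AntitoneOn g (Set.Ici 0) := by
    refine antitoneOn_of_hasDerivWithinAt_nonpos (convex_Ici 0)
      (fun r _ => (hg r).continuousAt.continuousWithinAt)
      (fun r _ => (hg r).hasDerivWithinAt) fun r hr => ?_
    rw [interior_Ici] at hr
    have hr0 : 0 < r := hr
    have h1 := inner_le_conjNorm_mul (nrm i) (hnrm i) t
      (gradient f (x + embed i (r • t)) i - gradient f x i)
    have h2 := mul_le_mul_of_nonneg_right (hf.lipschitz x i (r • t)) (apply_nonneg (nrm i) t)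
    rw [map_smul_eq_mul, Real.norm_eq_abs, abs_of_pos hr0] at h2
    rw [inner_sub_right, real_inner_comm, real_inner_comm _ t] at h1
    rw [inner_embed, smul_embed]
    nlinarith
  have := hanti (Set.mem_Ici.2 le_rfl) (Set.mem_Ici.2 zero_le_one) zero_le_one
  simp only [g, one_smul, zero_smul, add_zero] at this
  linarith

theorem convexOn_smoothPart {nrm : (i : Fin n) → Seminorm ℝ (Block N i)}
    {f : BlockSpace N → ℝ} {𝒥 : Finset (Finset (Fin n))}
    {fJ : Finset (Fin n) → BlockSpace N → ℝ} {L : Fin n → ℝ} (hf : SmoothPart nrm f 𝒥 fJ L) :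
    ConvexOn ℝ Set.univ f := by
  refine ⟨convex_univ, fun x _ y _ a b ha hb hab => ?_⟩
  simp only [hf.separable, smul_eq_mul, Finset.mul_sum]
  rw [← Finset.sum_add_distrib]
  exact Finset.sum_le_sum fun J hJ => (hf.convex J hJ).2 trivial trivial ha hb hab

theorem SmoothPart.inner_gradient_le {nrm : (i : Fin n) → Seminorm ℝ (Block N i)}
    {f : BlockSpace N → ℝ} {𝒥 : Finset (Finset (Fin n))}
    {fJ : Finset (Fin n) → BlockSpace N → ℝ} {L : Fin n → ℝ} (hf : SmoothPart nrm f 𝒥 fJ L)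
    (x y : BlockSpace N) : f x + inner ℝ (gradient f x) (y - x) ≤ f y := by
  have hc : ConvexOn ℝ Set.univ fun r : ℝ => f (x + r • (y - x)) := by
    refine ⟨convex_univ, fun r _ r' _ a b ha hb hab => ?_⟩
    convert (convexOn_smoothPart hf).2 (Set.mem_univ (x + r • (y - x)))
      (Set.mem_univ (x + r' • (y - x))) ha hb hab using 2
    have : a • x + b • x = x := by rw [← add_smul, hab, one_smul]
    rw [smul_add, smul_add, add_add_add_comm, this]
    simp only [smul_smul, smul_eq_mul, add_smul]
  have h := hc.le_slope_of_hasDerivAt (Set.mem_univ 0) (Set.mem_univ 1) one_pos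
    (hasDerivAt_line hf.differentiable x (y - x) 0)
  simp only [slope_def_field, zero_smul, add_zero, one_smul, add_sub_cancel, sub_zero,
    div_one] at h
  linarith

theorem SmoothPart.isSubgradient {nrm : (i : Fin n) → Seminorm ℝ (Block N i)}
    {f : BlockSpace N → ℝ} {𝒥 : Finset (Finset (Fin n))}
    {fJ : Finset (Fin n) → BlockSpace N → ℝ} {L : Fin n → ℝ} (hf : SmoothPart nrm f 𝒥 fJ L)
    (x : BlockSpace N) : IsSubgradient (fun x => (f x : EReal)) x (gradient f x) := by
  intro y
  dsimp only
  exact_mod_cast hf.inner_gradient_le x y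

theorem SmoothPart.strong_inner_gradient_le {nrm : (i : Fin n) → Seminorm ℝ (Block N i)}
    {f : BlockSpace N → ℝ} {𝒥 : Finset (Finset (Fin n))}
    {fJ : Finset (Fin n) → BlockSpace N → ℝ} {L : Fin n → ℝ} (hf : SmoothPart nrm f 𝒥 fJ L)
    {μf : ℝ} (hμf : StronglyConvexWith (wNorm nrm L) (fun x => (f x : EReal)) μf)
    (x y : BlockSpace N) :
    f x + inner ℝ (gradient f x) (y - x) + μf / 2 * wNorm nrm L (y - x) ^ 2 ≤ f y := by
  have := hμf.2 x y (EReal.coe_ne_top _) (EReal.coe_ne_top _) _ (hf.isSubgradient x)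
  rw [add_assoc]
  dsimp only at this
  exact_mod_cast this

/-- Jensen: the endpoint of the joint step is the uniform average of endpoints of single steps, each
lengthened by the factor `T.card`. -/
theorem ConvexOn.map_add_sum_le {E ι : Type*} [AddCommGroup E] [Module ℝ E] {φ : E → ℝ}
    (hφ : ConvexOn ℝ Set.univ φ) (x : E) (T : Finset ι) (hT : T.Nonempty) (v : ι → E) :
    φ (x + ∑ i ∈ T, v i) ≤ ∑ i ∈ T, (T.card : ℝ)⁻¹ * φ (x + (T.card : ℝ) • v i) := by
  have hk : (T.card : ℝ) ≠ 0 := by exact_mod_cast hT.card_pos.ne'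
  have h1 : ∑ i ∈ T, (T.card : ℝ)⁻¹ = 1 := by
    rw [Finset.sum_const, nsmul_eq_mul, mul_inv_cancel₀ hk]
  have h := hφ.map_sum_le (t := T) (w := fun _ => (T.card : ℝ)⁻¹)
    (p := fun i => x + (T.card : ℝ) • v i) (fun _ _ => by positivity) h1 (fun _ _ => trivial)
  have h2 : ∑ i ∈ T, (T.card : ℝ)⁻¹ • (x + (T.card : ℝ) • v i) = x + ∑ i ∈ T, v i := by
    simp only [smul_add, Finset.sum_add_distrib, smul_smul, inv_mul_cancel₀ hk, one_smul]
    rw [← Finset.sum_smul, h1, one_smul]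
  rw [h2] at h
  simpa using h

/-- Padding gives all sets the same class counts, as the symmetry argument requires. -/
theorem exists_superset_fibre_card_eq {ι κ : Type*} [Fintype ι] [DecidableEq ι] [Fintype κ]
    [DecidableEq κ] {cl : ι → κ} {s ξ : ℕ} (hs : ∀ c, (Finset.univ.filter (cl · = c)).card = s)
    (hξ : ξ ≤ s) {J : Finset ι} (hJ : ∀ c, (J.filter (cl · = c)).card ≤ ξ) :
    ∃ A : Finset ι, J ⊆ A ∧ ∀ c, (A.filter (cl · = c)).card = ξ := by
  choose A h1 h2 h3 using fun c => Finset.exists_subsuperset_card_eq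
    (Finset.filter_subset_filter (cl · = c) J.subset_univ) (hJ c) ((hs c).symm ▸ hξ)
  refine ⟨Finset.univ.biUnion A, fun j hj => ?_, fun c => ?_⟩
  · exact Finset.mem_biUnion.2 ⟨cl j, Finset.mem_univ _, h1 _ (by simp [hj])⟩
  · rw [← h3 c]
    congr 1
    ext j
    simp only [Finset.mem_filter, Finset.mem_biUnion, Finset.mem_univ, true_and]
    constructor
    · rintro ⟨⟨c', hc'⟩, rfl⟩
      have : cl j = c' := by simpa using h2 c' hc'
      rwa [this]
    · intro hj
      exact ⟨⟨c, hj⟩, by simpa using h2 c hj⟩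

end Blocks

/-! ### The expected separable overapproximation of the smooth part. -/

section ExpectedSeparableOverapproximation

open Finset

variable {n C : ℕ} {N : Fin n → ℕ}

theorem SmoothPart.eq_of_forall_eq {nrm : (i : Fin n) → Seminorm ℝ (Block N i)}
    {f : BlockSpace N → ℝ} {𝒥 : Finset (Finset (Fin n))}
    {fJ : Finset (Fin n) → BlockSpace N → ℝ} {L : Fin n → ℝ} (hf : SmoothPart nrm f 𝒥 fJ L)
    (h𝒥 : ∀ J ∈ 𝒥, J = ∅) (x y : BlockSpace N) : f x = f y := by
  rw [hf.separable, hf.separable]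
  refine sum_congr rfl fun J hJ => hf.dependsOn J hJ _ _ fun i hi => ?_
  rw [h𝒥 J hJ] at hi
  simp at hi

/-- The expected separable overapproximation of a smooth part all of whose sets have at most `ξ`
elements in each class. -/
theorem SmoothPart.sum_samples_le {nrm : (i : Fin n) → Seminorm ℝ (Block N i)}
    (hnrm : ∀ i t, nrm i t = 0 → t = 0)
    {f : BlockSpace N → ℝ} {𝒥 : Finset (Finset (Fin n))}
    {fJ : Finset (Fin n) → BlockSpace N → ℝ} {L : Fin n → ℝ} (hf : SmoothPart nrm f 𝒥 fJ L)
    {cl : Fin n → Fin C} {s τ ξ : ℕ} (hs0 : 0 < s) (hs : ∀ c, #{i | cl i = c} = s)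
    (hξ1 : 1 ≤ ξ) (hξs : ξ ≤ s) (h𝒥 : ∀ J ∈ 𝒥, ∀ c, #{i ∈ J | cl i = c} ≤ ξ)
    (x h : BlockSpace N) :
    ∑ S ∈ samples cl τ, f (x + ∑ i ∈ S, embed i (h i)) ≤
      #(samples cl τ) * (f x + (τ : ℝ) / s *
        (inner ℝ (gradient f x) h + stepParam C s τ ξ / 2 * wNorm nrm L h ^ 2)) := by
  have hA : ∀ J : Finset (Fin n), ∃ A, J ∈ 𝒥 → J ⊆ A ∧ ∀ c, #{i ∈ A | cl i = c} = ξ := fun J => by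
    by_cases hJ : J ∈ 𝒥
    · obtain ⟨A, hA⟩ := exists_superset_fibre_card_eq hs hξs (h𝒥 J hJ)
      exact ⟨A, fun _ => hA⟩
    · exact ⟨∅, fun h => absurd h hJ⟩
  choose A hA using hA
  -- A reference set for each block, chosen without regard to `J`, that will stand in for every `A
  -- J` containing `i`.
  have hB : ∀ i : Fin n, ∃ B : Finset (Fin n), i ∈ B ∧ ∀ c, #{j ∈ B | cl j = c} = ξ := fun i => by
    obtain ⟨B, hB⟩ := exists_superset_fibre_card_eq hs hξs (J := {i})
      fun c => ((card_filter_le _ _).trans (by simp)).trans hξ1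
    exact ⟨B, hB.1 (mem_singleton_self i), hB.2⟩
  choose B hiB hB using hB
  let D : Finset (Fin n) → Fin n → ℕ → ℝ := fun J i k =>
    (k : ℝ)⁻¹ * (fJ J (x + (k : ℝ) • embed i (h i)) - fJ J x)
  -- Jensen's inequality for each summand and each sample
  have h1 : ∀ J ∈ 𝒥, ∀ S : Finset (Fin n), fJ J (x + ∑ i ∈ S, embed i (h i)) - fJ J x ≤
      ∑ i ∈ A J, if i ∈ S then D J i #(S ∩ A J) else 0 := by
    intro J hJ S
    rw [← sum_filter, filter_mem_eq_inter, inter_comm]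
    have e : fJ J (x + ∑ i ∈ S, embed i (h i)) = fJ J (x + ∑ i ∈ S ∩ A J, embed i (h i)) := by
      refine hf.dependsOn J hJ _ _ fun j hj => ?_
      simp only [PiLp.add_apply, sum_embed_apply, mem_inter, (hA J hJ).1 hj, and_true]
    rw [e]
    rcases (S ∩ A J).eq_empty_or_nonempty with h0 | h0
    · simp [h0]
    · refine (sub_le_sub_right (ConvexOn.map_add_sum_le (hf.convex J hJ) x _ h0 _) _).trans_eq ?_
      have hk : (#(S ∩ A J) : ℝ) ≠ 0 := by exact_mod_cast h0.card_pos.ne'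
      simp only [D, mul_sub, sum_sub_distrib, sum_const, nsmul_eq_mul]
      rw [mul_inv_cancel_left₀ hk]
  have h2 : ∀ J ∈ 𝒥, ∑ S ∈ samples cl τ, (fJ J (x + ∑ i ∈ S, embed i (h i)) - fJ J x) ≤
      ∑ i, ∑ S ∈ samples cl τ with i ∈ S, D J i #(S ∩ B i) := by
    intro J hJ
    refine (sum_le_sum fun S _ => h1 J hJ S).trans_eq ?_
    rw [sum_comm]
    -- Blocks outside `A J` lie outside `J`, where the difference quotient of `f_J` vanishes, so the
    -- sum extends to all blocks.
    refine sum_subset_zero_on_sdiff (subset_univ _) (fun i hi => ?_) fun i hi => ?_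
    · have hiJ : i ∉ J := fun hiJ => (mem_sdiff.1 hi).2 ((hA J hJ).1 hiJ)
      refine sum_eq_zero fun S _ => ?_
      have : fJ J (x + (#(S ∩ B i) : ℝ) • embed i (h i)) = fJ J x := by
        refine hf.dependsOn J hJ _ _ fun j hj => ?_
        have hji : j ≠ i := by
          rintro rfl
          exact hiJ hj
        simp [embed_apply_of_ne hji]
      simp [D, this]
    · rw [← sum_filter]
      exact sum_samples_card_inter hi (hiB i) (fun c => by rw [(hA J hJ).2, hB]) (D J i)
  -- The step length no longer depends on `J`, so the quotients add up to one of `f` itself along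
  -- block `i`.
  have h3 : ∀ i, ∀ S ∈ (samples cl τ).filter (i ∈ ·), ∑ J ∈ 𝒥, D J i #(S ∩ B i) ≤
      inner ℝ (gradient f x i) (h i) + #(S ∩ B i) * (L i / 2 * nrm i (h i) ^ 2) := by
    intro i S hS
    have hk : (0 : ℝ) < #(S ∩ B i) := by
      exact_mod_cast card_pos.2 ⟨i, mem_inter.2 ⟨(mem_filter.1 hS).2, hiB i⟩⟩
    have e := hf.le_quadratic hnrm x i ((#(S ∩ B i) : ℝ) • h i)
    rw [← smul_embed, inner_smul_right, map_smul_eq_mul, Real.norm_eq_abs, abs_of_pos hk] at e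
    simp only [D, ← mul_sum, sum_sub_distrib, ← hf.separable]
    rw [inv_mul_le_iff₀ hk]
    linarith
  have h4 := cast_card_samples_mem (τ := τ) hs0 hs
  have h5 : ∑ S ∈ samples cl τ, (f (x + ∑ i ∈ S, embed i (h i)) - f x) ≤
      ∑ i, τ / s * #(samples cl τ) * (inner ℝ (gradient f x i) (h i) +
        stepParam C s τ ξ * (L i / 2 * nrm i (h i) ^ 2)) := by
    calc _ = ∑ J ∈ 𝒥, ∑ S ∈ samples cl τ, (fJ J (x + ∑ i ∈ S, embed i (h i)) - fJ J x) := by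
          rw [sum_comm]
          simp only [hf.separable, sum_sub_distrib]
      _ ≤ ∑ J ∈ 𝒥, ∑ i, ∑ S ∈ samples cl τ with i ∈ S, D J i #(S ∩ B i) :=
          sum_le_sum fun J hJ => h2 J hJ
      _ = ∑ i, ∑ S ∈ samples cl τ with i ∈ S, ∑ J ∈ 𝒥, D J i #(S ∩ B i) := by
          rw [sum_comm]
          exact sum_congr rfl fun i _ => sum_comm
      _ ≤ _ := by
          refine sum_le_sum fun i _ => (sum_le_sum (h3 i)).trans_eq ?_
          rw [sum_add_distrib, sum_const, nsmul_eq_mul, ← sum_mul,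
            sum_samples_card_inter_eq hs (hiB i) (hB i), h4, Fintype.card_fin]
          ring
  rw [sum_sub_distrib, sum_const, nsmul_eq_mul, ← mul_sum, sum_add_distrib, ← mul_sum] at h5
  rw [wNorm_sq nrm hf.lipschitz_pos, PiLp.inner_apply]
  have : ∑ i, L i / 2 * nrm i (h i) ^ 2 = (∑ i, L i * nrm i (h i) ^ 2) / 2 := by
    rw [sum_div]
    exact sum_congr rfl fun i _ => by ring
  rw [this] at h5
  linarith

end ExpectedSeparableOverapproximation

end DBCD

namespace DBCD

/-! ### Sums of extended reals and lower semicontinuity from a closed epigraph. -/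

section EReal

theorem EReal.coe_sum' {ι : Type*} (s : Finset ι) (a : ι → ℝ) :
    ((∑ i ∈ s, a i : ℝ) : EReal) = ∑ i ∈ s, (a i : EReal) := by
  classical
  induction s using Finset.induction_on with
  | empty => simp
  | insert i s hi ih => rw [Finset.sum_insert hi, Finset.sum_insert hi, EReal.coe_add, ih]

theorem EReal.sum_ne_bot {ι : Type*} {s : Finset ι} {a : ι → EReal} (h : ∀ i ∈ s, a i ≠ ⊥) :
    ∑ i ∈ s, a i ≠ ⊥ := by
  classical
  induction s using Finset.induction_on with
  | empty => simp
  | insert i s hi ih =>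
    rw [Finset.sum_insert hi]
    exact EReal.add_ne_bot_iff.2 ⟨h i (by simp), ih fun j hj => h j (by simp [hj])⟩

theorem EReal.sum_ne_top_iff {ι : Type*} {s : Finset ι} {a : ι → EReal} (h : ∀ i ∈ s, a i ≠ ⊥) :
    ∑ i ∈ s, a i ≠ ⊤ ↔ ∀ i ∈ s, a i ≠ ⊤ := by
  classical
  induction s using Finset.induction_on with
  | empty => simp
  | insert i s hi ih =>
    rw [Finset.sum_insert hi, EReal.add_ne_top_iff_ne_top₂ (h i (by simp))
      (EReal.sum_ne_bot fun j hj => h j (by simp [hj])), ih fun j hj => h j (by simp [hj])]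
    simp

theorem lowerSemicontinuous_of_isClosed_epigraph {E : Type*} [TopologicalSpace E] {φ : E → EReal}
    (hφ : IsClosed (epigraph φ)) : LowerSemicontinuous φ := by
  rw [lowerSemicontinuous_iff_isClosed_preimage]
  have hreal (r : ℝ) : IsClosed (φ ⁻¹' Set.Iic (r : EReal)) :=
    hφ.preimage (f := fun x : E => (x, r)) (by fun_prop)
  intro y
  induction y with
  | bot =>
    have : φ ⁻¹' Set.Iic ⊥ = ⋂ r : ℝ, φ ⁻¹' Set.Iic (r : EReal) := by
      ext x
      simp only [Set.mem_preimage, Set.mem_Iic, le_bot_iff, Set.mem_iInter]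
      refine ⟨fun h r => h ▸ bot_le, fun h => (EReal.eq_bot_iff_forall_lt _).2 fun r => ?_⟩
      exact (h (r - 1)).trans_lt (by exact_mod_cast sub_one_lt r)
    rw [this]
    exact isClosed_iInter hreal
  | coe r => exact hreal r
  | top => simp

end EReal

/-! ### Strong convexity along segments, by approximation with points that have subgradients. -/

section SubgradientApproximation

variable {n : ℕ} {N : Fin n → ℕ} {φ : BlockSpace N → EReal}

theorem convex_epigraph_toReal {E : Type*} [AddCommGroup E] [Module ℝ E] {φ : E → EReal}
    (hbot : ∀ x, φ x ≠ ⊥) (hconv : Convex ℝ (epigraph φ)) {x y : E} (hx : φ x ≠ ⊤) (hy : φ y ≠ ⊤)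
    {a b : ℝ} (ha : 0 ≤ a) (hb : 0 ≤ b) (hab : a + b = 1) :
    φ (a • x + b • y) ≠ ⊤ ∧
      (φ (a • x + b • y)).toReal ≤ a * (φ x).toReal + b * (φ y).toReal := by
  have h : φ (a • x + b • y) ≤ ((a * (φ x).toReal + b * (φ y).toReal : ℝ) : EReal) :=
    hconv (show (x, (φ x).toReal) ∈ epigraph φ from EReal.le_coe_toReal hx)
      (show (y, (φ y).toReal) ∈ epigraph φ from EReal.le_coe_toReal hy) ha hb hab
  have htop := ne_top_of_le_ne_top (EReal.coe_ne_top _) h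
  refine ⟨htop, ?_⟩
  rwa [← EReal.coe_le_coe_iff, EReal.coe_toReal htop (hbot _)]

/-- Every point of the domain of a closed convex function is the limit of points where the
function has a subgradient. -/
theorem exists_isSubgradient_near (hbot : ∀ x, φ x ≠ ⊥) (hconv : Convex ℝ (epigraph φ))
    (hlsc : LowerSemicontinuous φ) {z : BlockSpace N} (hz : φ z ≠ ⊤) {ε : ℝ} (hε : 0 < ε) :
    ∃ u g, φ u ≠ ⊤ ∧ ‖u - z‖ ≤ ε ∧ IsSubgradient φ u g ∧ 0 ≤ inner ℝ g (z - u) := by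
  have hzb : z ∈ Metric.closedBall z ε := Metric.mem_closedBall_self hε.le
  obtain ⟨u₀, -, hu₀⟩ := hlsc.lowerSemicontinuousOn (Metric.closedBall z ε)
    |>.exists_isMinOn ⟨z, hzb⟩ (isCompact_closedBall z ε)
  have hu₀top : φ u₀ ≠ ⊤ := ne_top_of_le_ne_top hz (hu₀ hzb)
  obtain ⟨m, hm⟩ : ∃ m : ℝ, φ u₀ = m := ⟨_, (EReal.coe_toReal hu₀top (hbot _)).symm⟩
  -- With `m` the minimum of `φ` on the ball, this penalty makes reaching the boundary cost more
  -- than `φ` can drop, so the penalized minimizer is interior.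
  set c : ℝ := ((φ z).toReal - m) / ε ^ 2 + 1 with hc
  have hmz : m ≤ (φ z).toReal := by
    rw [← EReal.coe_le_coe_iff, EReal.coe_toReal hz (hbot _), ← hm]
    exact hu₀ hzb
  have hc0 : 0 < c := by
    have : 0 ≤ ((φ z).toReal - m) / ε ^ 2 := div_nonneg (by linarith) (by positivity)
    linarith
  have hcε : (φ z).toReal - m < c * ε ^ 2 := by
    rw [hc, add_mul, div_mul_cancel₀ _ (by positivity)]
    have : 0 < ε ^ 2 := by positivity
    linarith
  have hq : Continuous fun v : BlockSpace N => ((c * ‖v - z‖ ^ 2 : ℝ) : EReal) :=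
    continuous_coe_real_ereal.comp (by fun_prop)
  have hlsc' : LowerSemicontinuous fun v => φ v + ((c * ‖v - z‖ ^ 2 : ℝ) : EReal) :=
    hlsc.add' hq.lowerSemicontinuous fun v =>
      EReal.continuousAt_add (Or.inr (EReal.coe_ne_bot _)) (Or.inr (EReal.coe_ne_top _))
  obtain ⟨u, hub, hu⟩ := hlsc'.lowerSemicontinuousOn (Metric.closedBall z ε)
    |>.exists_isMinOn ⟨z, hzb⟩ (isCompact_closedBall z ε)
  have hutop : φ u ≠ ⊤ := by
    have h := hu hzb
    simp only [Set.mem_ofPred_eq, sub_self, norm_zero] at h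
    have h' := ne_top_of_le_ne_top (EReal.add_ne_top hz (EReal.coe_ne_top _)) h
    exact (EReal.add_ne_top_iff_ne_top_left (EReal.coe_ne_bot _) (EReal.coe_ne_top _)).1 h'
  have hureal : ∀ v ∈ Metric.closedBall z ε, φ v ≠ ⊤ →
      (φ u).toReal + c * ‖u - z‖ ^ 2 ≤ (φ v).toReal + c * ‖v - z‖ ^ 2 := by
    intro v hv hvtop
    have h : φ u + ((c * ‖u - z‖ ^ 2 : ℝ) : EReal) ≤ φ v + ((c * ‖v - z‖ ^ 2 : ℝ) : EReal) := hu hv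
    rw [← EReal.coe_toReal hutop (hbot _), ← EReal.coe_toReal hvtop (hbot _)] at h
    exact_mod_cast h
  have huz : ‖u - z‖ < ε := by
    have h1 := hureal z hzb hz
    have h2 : m ≤ (φ u).toReal := by
      rw [← EReal.coe_le_coe_iff, EReal.coe_toReal hutop (hbot _), ← hm]
      exact hu₀ hub
    rw [sub_self, norm_zero] at h1
    have h3 : c * ‖u - z‖ ^ 2 < c * ε ^ 2 := by linarith
    exact lt_of_pow_lt_pow_left₀ 2 hε.le (lt_of_mul_lt_mul_left h3 hc0.le)
  -- The subgradient is minus the gradient of the penalty at the minimizer `u`; its pairing with `z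
  -- - u` is `2 * c * ‖z - u‖ ^ 2`.
  refine ⟨u, (2 * c) • (z - u), hutop, huz.le, fun v => ?_, ?_⟩
  · by_cases hv : φ v = ⊤
    · simp [hv]
    rw [← EReal.coe_toReal hutop (hbot _), ← EReal.coe_toReal hv (hbot _), ← EReal.coe_add,
      EReal.coe_le_coe_iff]
    refine le_of_forall_pos_le_add fun η hη => ?_
    -- Small enough that the move from `u` towards `v` stays in the ball and leaves a quadratic
    -- error of at most `η` after division by `θ`; each `+ 1` keeps a denominator positive.
    set θ : ℝ := min 1 (min ((ε - ‖u - z‖) / (‖v - u‖ + 1)) (η / (c * ‖v - u‖ ^ 2 + 1))) with hθ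
    have hθ0 : 0 < θ := lt_min one_pos (lt_min (div_pos (by linarith) (by positivity))
      (by positivity))
    have hθ1 : θ ≤ 1 := min_le_left _ _
    have hθ2 : θ * ‖v - u‖ ≤ ε - ‖u - z‖ := by
      have h1 : θ ≤ (ε - ‖u - z‖) / (‖v - u‖ + 1) := (min_le_right _ _).trans (min_le_left _ _)
      rw [le_div_iff₀ (by positivity)] at h1
      linarith
    have hθ3 : θ * (c * ‖v - u‖ ^ 2) ≤ η := by
      have h1 : θ ≤ η / (c * ‖v - u‖ ^ 2 + 1) := (min_le_right _ _).trans (min_le_right _ _)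
      rw [le_div_iff₀ (by positivity)] at h1
      linarith
    obtain ⟨hwtop, hw⟩ := convex_epigraph_toReal hbot hconv hutop hv (sub_nonneg.2 hθ1) hθ0.le
      (sub_add_cancel _ _)
    set w := (1 - θ) • u + θ • v with hwdef
    have hwz : w - z = (u - z) + θ • (v - u) := by rw [hwdef]; module
    have hwb : w ∈ Metric.closedBall z ε := by
      rw [mem_closedBall_iff_norm, hwz]
      refine (norm_add_le _ _).trans ?_
      rw [norm_smul, Real.norm_eq_abs, abs_of_pos hθ0]
      linarith
    have h1 := hureal w hwb hwtop
    rw [hwz, norm_add_sq_real, norm_smul, Real.norm_eq_abs, abs_of_pos hθ0, inner_smul_right] at h1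
    have h2 : inner ℝ ((2 * c) • (z - u)) (v - u) = -(2 * c * inner ℝ (u - z) (v - u)) := by
      rw [← neg_sub u z, smul_neg, inner_neg_left, inner_smul_left, RCLike.conj_to_real]
    rw [h2]
    have h3 : θ * ((φ u).toReal + -(2 * c * inner ℝ (u - z) (v - u))) ≤
        θ * ((φ v).toReal + θ * (c * ‖v - u‖ ^ 2)) := by nlinarith
    have h4 := le_of_mul_le_mul_left h3 hθ0
    linarith
  · rw [inner_smul_left, RCLike.conj_to_real, real_inner_self_eq_norm_sq]
    positivity

/-- The intermediate point `z` may have no subgradient. At a nearby `u` that has one, the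
inequalities towards `x` and `y` are averaged; the linear term `⟨g, z - u⟩` is nonnegative and can
be dropped, after which `u` tends to `z`. -/
theorem StronglyConvexWith.toReal_le {p : BlockSpace N → ℝ} (hp : Continuous p) {μ : ℝ}
    (hφ : StronglyConvexWith p φ μ) (hbot : ∀ x, φ x ≠ ⊥) (hconv : Convex ℝ (epigraph φ))
    (hlsc : LowerSemicontinuous φ) {x y : BlockSpace N} (hx : φ x ≠ ⊤) (hy : φ y ≠ ⊤) {a b : ℝ}
    (ha : 0 ≤ a) (hb : 0 ≤ b) (hab : a + b = 1) :
    (φ (a • x + b • y)).toReal + μ / 2 *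
      (a * p (x - (a • x + b • y)) ^ 2 + b * p (y - (a • x + b • y)) ^ 2) ≤
      a * (φ x).toReal + b * (φ y).toReal := by
  have hz := (convex_epigraph_toReal hbot hconv hx hy ha hb hab).1
  set z := a • x + b • y with hzdef
  let Q : BlockSpace N → ℝ := fun u => μ / 2 * (a * p (x - u) ^ 2 + b * p (y - u) ^ 2)
  have hQ : Continuous Q := by fun_prop
  refine le_of_forall_pos_sub_le fun η hη => ?_
  have e1 : ∀ᶠ u in nhds z, (((φ z).toReal - η / 2 : ℝ) : EReal) < φ u := by
    refine hlsc z _ (lt_of_lt_of_eq ?_ (EReal.coe_toReal hz (hbot _)))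
    rw [EReal.coe_lt_coe_iff]
    linarith
  have e2 : ∀ᶠ u in nhds z, Q z - η / 2 < Q u :=
    hQ.continuousAt.eventually (lt_mem_nhds (by linarith))
  obtain ⟨ε, hε, hball⟩ := Metric.eventually_nhds_iff.1 (e1.and e2)
  obtain ⟨u, g, hu, huz, hg, hgz⟩ := exists_isSubgradient_near hbot hconv hlsc hz (half_pos hε)
  obtain ⟨h1, h2⟩ := hball (y := u) (by rw [dist_eq_norm]; linarith)
  rw [← EReal.coe_toReal hu (hbot _), EReal.coe_lt_coe_iff] at h1
  have h3 := hφ.2 u x hu hx g hg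
  have h4 := hφ.2 u y hu hy g hg
  rw [← EReal.coe_toReal hu (hbot _), ← EReal.coe_toReal hx (hbot _), ← EReal.coe_add,
    EReal.coe_le_coe_iff] at h3
  rw [← EReal.coe_toReal hu (hbot _), ← EReal.coe_toReal hy (hbot _), ← EReal.coe_add,
    EReal.coe_le_coe_iff] at h4
  have h5 : inner ℝ g (z - u) = a * inner ℝ g (x - u) + b * inner ℝ g (y - u) := by
    rw [← inner_smul_right, ← inner_smul_right, ← inner_add_right]
    congr 1
    have : u = a • u + b • u := by rw [← add_smul, hab, one_smul]
    rw [hzdef, smul_sub, smul_sub, sub_add_sub_comm, ← this]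
  have h6 := mul_le_mul_of_nonneg_left h3 ha
  have h7 := mul_le_mul_of_nonneg_left h4 hb
  have h8 : (φ u).toReal = a * (φ u).toReal + b * (φ u).toReal := by rw [← add_mul, hab, one_mul]
  change (φ z).toReal + Q z - η ≤ _
  have h9 : Q u = μ / 2 * (a * p (x - u) ^ 2 + b * p (y - u) ^ 2) := rfl
  nlinarith

end SubgradientApproximation

/-! ### The separable regularizer: finiteness, semicontinuity, convexity. -/

section Regularizer

variable {n : ℕ} {N : Fin n → ℕ} {Om : (i : Fin n) → Block N i → EReal}

theorem Regularizer.separableSum_ne_bot (hOm : Regularizer Om) (x : BlockSpace N) :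
    separableSum Om x ≠ ⊥ :=
  EReal.sum_ne_bot fun i _ => hOm.ne_bot i _

theorem Regularizer.separableSum_ne_top_iff (hOm : Regularizer Om) {x : BlockSpace N} :
    separableSum Om x ≠ ⊤ ↔ ∀ i, Om i (x i) ≠ ⊤ := by
  simpa [separableSum] using EReal.sum_ne_top_iff (s := Finset.univ) (a := fun i => Om i (x i))
    fun i _ => hOm.ne_bot i _

theorem Regularizer.coe_separableSum (hOm : Regularizer Om) {x : BlockSpace N}
    (hx : separableSum Om x ≠ ⊤) :
    separableSum Om x = ((∑ i, (Om i (x i)).toReal : ℝ) : EReal) := by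
  rw [EReal.coe_sum']
  exact Finset.sum_congr rfl fun i _ =>
    (EReal.coe_toReal (hOm.separableSum_ne_top_iff.1 hx i) (hOm.ne_bot i _)).symm

theorem Regularizer.toReal_separableSum (hOm : Regularizer Om) {x : BlockSpace N}
    (hx : separableSum Om x ≠ ⊤) :
    (separableSum Om x).toReal = ∑ i, (Om i (x i)).toReal := by
  rw [hOm.coe_separableSum hx, EReal.toReal_coe]

theorem Regularizer.lowerSemicontinuous (hOm : Regularizer Om) :
    LowerSemicontinuous (separableSum Om) := by
  classical
  have h : ∀ s : Finset (Fin n),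
      LowerSemicontinuous fun x : BlockSpace N => ∑ i ∈ s, Om i (x i) := by
    intro s
    induction s using Finset.induction_on with
    | empty => simpa using lowerSemicontinuous_const
    | insert i s hi ih =>
      simp only [Finset.sum_insert hi]
      refine LowerSemicontinuous.add'
        ((lowerSemicontinuous_of_isClosed_epigraph (hOm.closed i)).comp (by fun_prop)) ih fun x =>
        EReal.continuousAt_add (Or.inr (EReal.sum_ne_bot fun j _ => hOm.ne_bot j _))
          (Or.inl (hOm.ne_bot i _))
  exact h Finset.univ

theorem Regularizer.convex_epigraph (hOm : Regularizer Om) :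
    Convex ℝ (epigraph (separableSum Om)) := by
  rintro ⟨x, r⟩ hx ⟨y, q⟩ hy a b ha hb hab
  have hx' : separableSum Om x ≤ r := hx
  have hy' : separableSum Om y ≤ q := hy
  have hxt := ne_top_of_le_ne_top (EReal.coe_ne_top _) hx'
  have hyt := ne_top_of_le_ne_top (EReal.coe_ne_top _) hy'
  have h i := convex_epigraph_toReal (hOm.ne_bot i) (hOm.convex i)
    (hOm.separableSum_ne_top_iff.1 hxt i) (hOm.separableSum_ne_top_iff.1 hyt i) ha hb hab
  have hzt : separableSum Om (a • x + b • y) ≠ ⊤ := hOm.separableSum_ne_top_iff.2 fun i => (h i).1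
  rw [hOm.coe_separableSum hxt, EReal.coe_le_coe_iff] at hx'
  rw [hOm.coe_separableSum hyt, EReal.coe_le_coe_iff] at hy'
  change separableSum Om (a • x + b • y) ≤ ((a * r + b * q : ℝ) : EReal)
  rw [hOm.coe_separableSum hzt, EReal.coe_le_coe_iff]
  calc _ ≤ ∑ i, (a * (Om i (x i)).toReal + b * (Om i (y i)).toReal) :=
        Finset.sum_le_sum fun i _ => (h i).2
    _ = a * ∑ i, (Om i (x i)).toReal + b * ∑ i, (Om i (y i)).toReal := by
        rw [Finset.sum_add_distrib, Finset.mul_sum, Finset.mul_sum]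
    _ ≤ a * r + b * q := by gcongr

theorem continuous_wNorm (nrm : (i : Fin n) → Seminorm ℝ (Block N i)) (w : Fin n → ℝ) :
    Continuous (wNorm nrm w) := by
  refine Real.continuous_sqrt.comp (continuous_finsetSum _ fun i _ => continuous_const.mul
    (Continuous.pow ((continuous_seminorm (nrm i)).comp ?_) 2))
  fun_prop

theorem wNorm_smul_sq (nrm : (i : Fin n) → Seminorm ℝ (Block N i)) {w : Fin n → ℝ}
    (hw : ∀ i, 0 < w i) (r : ℝ) (x : BlockSpace N) :
    wNorm nrm w (r • x) ^ 2 = r ^ 2 * wNorm nrm w x ^ 2 := by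
  rw [wNorm_sq nrm hw, wNorm_sq nrm hw, Finset.mul_sum]
  refine Finset.sum_congr rfl fun i _ => ?_
  rw [PiLp.smul_apply, map_smul_eq_mul, mul_pow, Real.norm_eq_abs, sq_abs]
  ring

/-- Strong convexity of the regularizer along segments. -/
theorem Regularizer.strong_convex_segment (hOm : Regularizer Om)
    {nrm : (i : Fin n) → Seminorm ℝ (Block N i)} {w : Fin n → ℝ} (hw : ∀ i, 0 < w i) {μ : ℝ}
    (hμ : StronglyConvexWith (wNorm nrm w) (separableSum Om) μ) {x y : BlockSpace N}
    (hx : separableSum Om x ≠ ⊤) (hy : separableSum Om y ≠ ⊤) {a : ℝ} (ha : 0 ≤ a) (ha1 : a ≤ 1) :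
    separableSum Om (x + a • (y - x)) ≠ ⊤ ∧
    (separableSum Om (x + a • (y - x))).toReal ≤ (1 - a) * (separableSum Om x).toReal +
      a * (separableSum Om y).toReal - μ / 2 * (a * (1 - a)) * wNorm nrm w (y - x) ^ 2 := by
  have e : x + a • (y - x) = (1 - a) • x + a • y := by module
  have e1 : x - ((1 - a) • x + a • y) = (-a) • (y - x) := by module
  have e2 : y - ((1 - a) • x + a • y) = (1 - a) • (y - x) := by module
  have h := hμ.toReal_le (continuous_wNorm nrm w) hOm.separableSum_ne_bot hOm.convex_epigraph
    hOm.lowerSemicontinuous hx hy (sub_nonneg.2 ha1) ha (sub_add_cancel _ _)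
  rw [e1, e2, wNorm_smul_sq nrm hw, wNorm_smul_sq nrm hw] at h
  rw [e]
  refine ⟨(convex_epigraph_toReal hOm.separableSum_ne_bot hOm.convex_epigraph hx hy
    (sub_nonneg.2 ha1) ha (sub_add_cancel _ _)).1, ?_⟩
  linear_combination h

end Regularizer

end DBCD

namespace DBCD

/-! ### The objective and its infimum in real terms. -/

section Objective

variable {n : ℕ} {N : Fin n → ℕ} {Om : (i : Fin n) → Block N i → EReal} {f : BlockSpace N → ℝ}

theorem objective_ne_top_iff (f : BlockSpace N → ℝ) (Om : (i : Fin n) → Block N i → EReal)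
    {x : BlockSpace N} : objective f Om x ≠ ⊤ ↔ separableSum Om x ≠ ⊤ :=
  EReal.add_ne_top_iff_ne_top_right (EReal.coe_ne_bot _) (EReal.coe_ne_top _)

theorem Regularizer.objective_ne_bot (hOm : Regularizer Om) (f : BlockSpace N → ℝ)
    (x : BlockSpace N) : objective f Om x ≠ ⊥ :=
  EReal.add_ne_bot_iff.2 ⟨EReal.coe_ne_bot _, hOm.separableSum_ne_bot x⟩

theorem Regularizer.toReal_objective (hOm : Regularizer Om) (f : BlockSpace N → ℝ)
    {x : BlockSpace N} (hx : separableSum Om x ≠ ⊤) :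
    (objective f Om x).toReal = f x + (separableSum Om x).toReal := by
  rw [objective, EReal.toReal_add (EReal.coe_ne_top _) (EReal.coe_ne_bot _) hx
    (hOm.separableSum_ne_bot x), EReal.toReal_coe]

theorem Regularizer.le_toReal_objective (hOm : Regularizer Om) {Fstar : ℝ}
    (hFstar : ⨅ x, objective f Om x = (Fstar : EReal)) {x : BlockSpace N}
    (hx : separableSum Om x ≠ ⊤) : Fstar ≤ (objective f Om x).toReal := by
  rw [← EReal.coe_le_coe_iff, ← hFstar,
    EReal.coe_toReal ((objective_ne_top_iff f Om).2 hx) (hOm.objective_ne_bot f x)]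
  exact iInf_le _ x

theorem Regularizer.exists_toReal_objective_lt (hOm : Regularizer Om) {Fstar : ℝ}
    (hFstar : ⨅ x, objective f Om x = (Fstar : EReal)) {η : ℝ} (hη : 0 < η) :
    ∃ y, separableSum Om y ≠ ⊤ ∧ (objective f Om y).toReal < Fstar + η := by
  have h : ⨅ x, objective f Om x < ((Fstar + η : ℝ) : EReal) := by
    rw [hFstar, EReal.coe_lt_coe_iff]
    linarith
  obtain ⟨y, hy⟩ := iInf_lt_iff.1 h
  have hy' : objective f Om y ≠ ⊤ := ne_top_of_lt hy
  refine ⟨y, (objective_ne_top_iff f Om).1 hy', ?_⟩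
  rwa [← EReal.coe_lt_coe_iff, EReal.coe_toReal hy' (hOm.objective_ne_bot f y)]

end Objective

/-! ### Expected decrease in one iteration. -/

section OneStep

open Finset

variable {n C : ℕ} {N : Fin n → ℕ}

/-- For `ξ = 0` the smooth part is constant and the formula can fall below `1`; nonnegativity is all
that remains, and it suffices. -/
theorem stepParam_zero_nonneg {C s τ : ℕ} (hτs : τ ≤ s) : 0 ≤ stepParam C s τ 0 := by
  have h : (τ : ℝ) ≤ s := by exact_mod_cast hτs
  have h1 : ((τ : ℝ) - 1) / max 1 ((s : ℝ) - 1) ≤ 1 := by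
    rw [div_le_one (lt_max_of_lt_left one_pos)]
    exact (sub_le_sub_right h 1).trans (le_max_right _ _)
  have e : stepParam C s τ 0 = 1 - ((τ : ℝ) - 1) / max 1 ((s : ℝ) - 1) := by
    rw [stepParam]
    push_cast
    ring
  rw [e]
  linarith

theorem one_le_stepParam {C s τ ξ : ℕ} (hC : 1 ≤ C) (hτ : 1 ≤ τ) (hξ : 1 ≤ ξ) :
    1 ≤ stepParam C s τ ξ := by
  have hC' : (0 : ℝ) ≤ (C : ℝ) - 1 := sub_nonneg.2 (by exact_mod_cast hC)
  have hτ' : (0 : ℝ) ≤ (τ : ℝ) - 1 := sub_nonneg.2 (by exact_mod_cast hτ)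
  have hξ' : (0 : ℝ) ≤ (ξ : ℝ) - 1 := sub_nonneg.2 (by exact_mod_cast hξ)
  have h1 : 0 ≤ ((ξ : ℝ) - 1) * ((τ : ℝ) - 1) / max 1 ((s : ℝ) - 1) :=
    div_nonneg (mul_nonneg hξ' hτ') (zero_le_one.trans (le_max_left _ _))
  have h2 : 0 ≤ ((C : ℝ) - 1) * ((ξ : ℝ) * (τ : ℝ) / (s : ℝ)) := mul_nonneg hC' (by positivity)
  rw [stepParam]
  linarith

variable {nrm : (i : Fin n) → Seminorm ℝ (Block N i)}
    {f : BlockSpace N → ℝ} {𝒥 : Finset (Finset (Fin n))}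
    {fJ : Finset (Fin n) → BlockSpace N → ℝ} {L : Fin n → ℝ}
    {Om : (i : Fin n) → Block N i → EReal}

theorem SmoothPart.gradient_eq_zero (hf : SmoothPart nrm f 𝒥 fJ L) (h𝒥 : ∀ J ∈ 𝒥, J = ∅)
    (x : BlockSpace N) : gradient f x = 0 := by
  have : f = fun _ => f 0 := funext fun y => hf.eq_of_forall_eq h𝒥 y 0
  rw [this]
  exact gradient_fun_const x (f 0)

theorem eq_empty_of_card_fibre_le_zero {cl : Fin n → Fin C} {J : Finset (Fin n)}
    (hJ : ∀ c, #{i ∈ J | cl i = c} ≤ 0) : J = ∅ := by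
  refine eq_empty_of_forall_notMem fun i hi => ?_
  have h := card_eq_zero.1 (Nat.le_zero.1 (hJ (cl i)))
  exact notMem_empty i (h ▸ mem_filter.2 ⟨hi, rfl⟩)

/-- The expected separable overapproximation, including the case of a constant smooth part. -/
theorem SmoothPart.sum_samples_le_of_le (hnrm : ∀ i t, nrm i t = 0 → t = 0)
    (hf : SmoothPart nrm f 𝒥 fJ L)
    {cl : Fin n → Fin C} {s τ ξ : ℕ} (hs0 : 0 < s) (hτs : τ ≤ s) (hs : ∀ c, #{i | cl i = c} = s)
    (hξs : ξ ≤ s) (h𝒥 : ∀ J ∈ 𝒥, ∀ c, #{i ∈ J | cl i = c} ≤ ξ) (x h : BlockSpace N) :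
    ∑ S ∈ samples cl τ, f (x + ∑ i ∈ S, embed i (h i)) ≤
      #(samples cl τ) * (f x + (τ : ℝ) / s *
        (inner ℝ (gradient f x) h + stepParam C s τ ξ / 2 * wNorm nrm L h ^ 2)) := by
  rcases Nat.eq_zero_or_pos ξ with rfl | hξ
  · have h0 : ∀ J ∈ 𝒥, J = ∅ := fun J hJ => eq_empty_of_card_fibre_le_zero (h𝒥 J hJ)
    rw [hf.gradient_eq_zero h0, inner_zero_left, sum_congr rfl fun S _ =>
      hf.eq_of_forall_eq h0 _ x, sum_const, nsmul_eq_mul]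
    refine mul_le_mul_of_nonneg_left ?_ (by positivity)
    have := stepParam_zero_nonneg (C := C) hτs
    have : 0 ≤ (τ : ℝ) / s * (0 + stepParam C s τ 0 / 2 * wNorm nrm L h ^ 2) := by positivity
    linarith
  · exact hf.sum_samples_le hnrm hs0 hs hξ hξs h𝒥 x h

/-- Along one block the strong convexity lower bound meets the quadratic upper bound, so `μf ≤ 1 ≤
β`. If `ξ = 0`, then `f` is constant and `μf ≤ 0 ≤ β`. This is what keeps the comparison step within
the segment. -/
theorem SmoothPart.mu_le_stepParam [Nontrivial (BlockSpace N)]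
    (hnrm : ∀ i t, nrm i t = 0 → t = 0) (hf : SmoothPart nrm f 𝒥 fJ L)
    {cl : Fin n → Fin C} {s τ ξ : ℕ} (hτ : 1 ≤ τ) (hτs : τ ≤ s)
    (h𝒥 : ∀ J ∈ 𝒥, ∀ c, #{i ∈ J | cl i = c} ≤ ξ)
    {μf : ℝ} (hμf : StronglyConvexWith (wNorm nrm L) (fun x => (f x : EReal)) μf) :
    μf ≤ stepParam C s τ ξ := by
  obtain ⟨v, hv⟩ := exists_ne (0 : BlockSpace N)
  obtain ⟨i, hi⟩ : ∃ i, v i ≠ 0 := by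
    by_contra! h
    exact hv (by ext i : 1; exact h i)
  have hC : 1 ≤ C := Nat.one_le_iff_ne_zero.2 (by rintro rfl; exact (cl i).elim0)
  have hpos : 0 < wNorm nrm L (embed i (v i)) ^ 2 := by
    rw [wNorm_sq nrm hf.lipschitz_pos]
    refine sum_pos' (fun j _ => mul_nonneg (hf.lipschitz_pos j).le (sq_nonneg _))
      ⟨i, mem_univ i, mul_pos (hf.lipschitz_pos i) (pow_pos ?_ 2)⟩
    rw [embed_apply_same]
    exact lt_of_le_of_ne (apply_nonneg _ _) fun e => hi (hnrm i _ e.symm)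
  have h1 := hf.strong_inner_gradient_le hμf 0 (0 + embed i (v i))
  rw [add_sub_cancel_left, inner_embed] at h1
  rcases Nat.eq_zero_or_pos ξ with rfl | hξ
  · have h0 : ∀ J ∈ 𝒥, J = ∅ := fun J hJ => eq_empty_of_card_fibre_le_zero (h𝒥 J hJ)
    rw [hf.gradient_eq_zero h0, hf.eq_of_forall_eq h0 (0 + embed i (v i)) 0, PiLp.zero_apply,
      inner_zero_left] at h1
    refine le_trans ?_ (stepParam_zero_nonneg hτs)
    by_contra! h
    nlinarith
  · refine le_trans ?_ (one_le_stepParam hC hτ hξ)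
    have h2 := hf.le_quadratic hnrm 0 i (v i)
    have h3 : wNorm nrm L (embed i (v i)) ^ 2 = L i * nrm i (v i) ^ 2 := by
      rw [wNorm_sq nrm hf.lipschitz_pos, sum_eq_single i]
      · rw [embed_apply_same]
      · intro j _ hj
        simp [embed_apply_of_ne hj]
      · simp
    by_contra! h
    nlinarith

variable {β : ℝ} {h : BlockSpace N → BlockSpace N}

theorem IsUpdateMap.ne_top (hh : IsUpdateMap nrm f Om β L h) {x : BlockSpace N} (i : Fin n)
    {t : Block N i} (ht : Om i (x i + t) ≠ ⊤) :
    Om i (x i + h x i) ≠ ⊤ := by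
  have h1 : ((inner ℝ (gradient f x i) (h x i) + β * L i / 2 * nrm i (h x i) ^ 2 : ℝ) : EReal) +
      Om i (x i + h x i) ≤ ((inner ℝ (gradient f x i) t + β * L i / 2 * nrm i t ^ 2 : ℝ) : EReal) +
      Om i (x i + t) := hh x i (Set.mem_univ t)
  have h2 := ne_top_of_le_ne_top (EReal.add_ne_top (EReal.coe_ne_top _) ht) h1
  exact (EReal.add_ne_top_iff_ne_top_right (EReal.coe_ne_bot _) (EReal.coe_ne_top _)).1 h2

theorem IsUpdateMap.toReal_le (hh : IsUpdateMap nrm f Om β L h) (hOm : Regularizer Om)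
    {x : BlockSpace N} (i : Fin n) {t : Block N i} (ht : Om i (x i + t) ≠ ⊤) :
    inner ℝ (gradient f x i) (h x i) + β * L i / 2 * nrm i (h x i) ^ 2 +
      (Om i (x i + h x i)).toReal ≤
    inner ℝ (gradient f x i) t + β * L i / 2 * nrm i t ^ 2 + (Om i (x i + t)).toReal := by
  have h1 : ((inner ℝ (gradient f x i) (h x i) + β * L i / 2 * nrm i (h x i) ^ 2 : ℝ) : EReal) +
      Om i (x i + h x i) ≤ ((inner ℝ (gradient f x i) t + β * L i / 2 * nrm i t ^ 2 : ℝ) : EReal) +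
      Om i (x i + t) := hh x i (Set.mem_univ t)
  rw [← EReal.coe_toReal ht (hOm.ne_bot _ _),
    ← EReal.coe_toReal (hh.ne_top i ht) (hOm.ne_bot _ _)] at h1
  exact_mod_cast h1

theorem IsUpdateMap.separableSum_ne_top (hh : IsUpdateMap nrm f Om β L h) (hOm : Regularizer Om)
    {x : BlockSpace N} (hx : separableSum Om x ≠ ⊤) (S : Finset (Fin n)) :
    separableSum Om (x + ∑ i ∈ S, embed i (h x i)) ≠ ⊤ := by
  rw [hOm.separableSum_ne_top_iff] at hx ⊢
  intro i
  rw [PiLp.add_apply, sum_embed_apply]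
  split_ifs
  · exact hh.ne_top i (t := 0) (by simpa using hx i)
  · simpa using hx i

/-- The update minimizes the separable model of the objective. -/
theorem IsUpdateMap.model_le (hh : IsUpdateMap nrm f Om β L h) (hOm : Regularizer Om)
    (hL : ∀ i, 0 < L i) {x t : BlockSpace N} (hxt : separableSum Om (x + t) ≠ ⊤) :
    inner ℝ (gradient f x) (h x) + β / 2 * wNorm nrm L (h x) ^ 2 +
      ∑ i, (Om i (x i + h x i)).toReal ≤
    inner ℝ (gradient f x) t + β / 2 * wNorm nrm L t ^ 2 + (separableSum Om (x + t)).toReal := by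
  have h1 := sum_le_sum fun i (_ : i ∈ univ) =>
    hh.toReal_le hOm i (t := t i) (hOm.separableSum_ne_top_iff.1 hxt i)
  rw [hOm.toReal_separableSum hxt, wNorm_sq nrm hL, wNorm_sq nrm hL, PiLp.inner_apply,
    PiLp.inner_apply]
  simp only [sum_add_distrib] at h1
  have e (v : BlockSpace N) : β / 2 * ∑ i, L i * nrm i (v i) ^ 2 =
      ∑ i, β * L i / 2 * nrm i (v i) ^ 2 := by
    rw [mul_sum]
    exact sum_congr rfl fun i _ => by ring
  rw [e, e]
  exact h1

/-- An equality by separability: each block is updated in the fraction `τ / s` of the samples. -/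
theorem sum_samples_separableSum (hOm : Regularizer Om) (hh : IsUpdateMap nrm f Om β L h)
    {cl : Fin n → Fin C} {s τ : ℕ} (hs0 : 0 < s) (hs : ∀ c, #{i | cl i = c} = s)
    {x : BlockSpace N} (hx : separableSum Om x ≠ ⊤) :
    ∑ S ∈ samples cl τ, (separableSum Om (x + ∑ i ∈ S, embed i (h x i))).toReal =
      #(samples cl τ) * ((1 - (τ : ℝ) / s) * (separableSum Om x).toReal +
        (τ : ℝ) / s * ∑ i, (Om i (x i + h x i)).toReal) := by
  have h4 := cast_card_samples_mem (τ := τ) hs0 hs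
  have h1 (S : Finset (Fin n)) : (separableSum Om (x + ∑ i ∈ S, embed i (h x i))).toReal =
      ∑ i, ((Om i (x i)).toReal +
        if i ∈ S then (Om i (x i + h x i)).toReal - (Om i (x i)).toReal else 0) := by
    rw [hOm.toReal_separableSum (hh.separableSum_ne_top hOm hx S)]
    refine sum_congr rfl fun i _ => ?_
    rw [PiLp.add_apply, sum_embed_apply]
    split_ifs <;> simp
  simp only [h1]
  rw [sum_comm, hOm.toReal_separableSum hx, mul_sum, mul_sum, ← sum_add_distrib, mul_sum]
  refine sum_congr rfl fun i _ => ?_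
  rw [sum_add_distrib, ← sum_filter, sum_const, sum_const, nsmul_eq_mul, nsmul_eq_mul, h4]
  ring

/-- One iteration decreases the expected optimality gap by a constant factor. -/
theorem sum_samples_objective_le (hnrm : ∀ i t, nrm i t = 0 → t = 0)
    (hf : SmoothPart nrm f 𝒥 fJ L) (hOm : Regularizer Om) {Fstar : ℝ}
    (hFstar : ⨅ x, objective f Om x = (Fstar : EReal))
    {cl : Fin n → Fin C} {s τ ξ : ℕ} (hτ : 1 ≤ τ) (hτs : τ ≤ s) (hs : ∀ c, #{i | cl i = c} = s)
    (hξs : ξ ≤ s) (h𝒥 : ∀ J ∈ 𝒥, ∀ c, #{i ∈ J | cl i = c} ≤ ξ)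
    (hβ : β = stepParam C s τ ξ) (hh : IsUpdateMap nrm f Om β L h) {μf μΩ : ℝ}
    (hμf : StronglyConvexWith (wNorm nrm L) (fun x => (f x : EReal)) μf)
    (hμΩ : StronglyConvexWith (wNorm nrm L) (separableSum Om) μΩ) (hμ : 0 < μf + μΩ)
    (hμβ : μf ≤ β) {x : BlockSpace N} (hx : separableSum Om x ≠ ⊤) :
    ∑ S ∈ samples cl τ, ((objective f Om (x + ∑ i ∈ S, embed i (h x i))).toReal - Fstar) ≤
      #(samples cl τ) * ((1 - (τ : ℝ) / s * ((μf + μΩ) / (β + μΩ))) *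
        ((objective f Om x).toReal - Fstar)) := by
  have hs0 : 0 < s := lt_of_lt_of_le hτ hτs
  -- The fraction of the segment from `x` to `y` used for comparison. It solves `β * l ^ 2 = l * μf
  -- + l * (1 - l) * μΩ`, so the quadratic terms cancel in `h6`.
  set l : ℝ := (μf + μΩ) / (β + μΩ) with hl
  have hβμ : 0 < β + μΩ := by linarith
  have hl0 : 0 < l := div_pos hμ hβμ
  have hl1 : l ≤ 1 := (div_le_one hβμ).2 (by linarith)
  have hlβ : l * (β + μΩ) = μf + μΩ := div_mul_cancel₀ _ hβμ.ne'
  have hκ : 0 < (τ : ℝ) / s := by positivity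
  set κ : ℝ := (τ : ℝ) / s with hκdef
  have key : ∀ y, separableSum Om y ≠ ⊤ →
      ∑ S ∈ samples cl τ, (objective f Om (x + ∑ i ∈ S, embed i (h x i))).toReal ≤
      #(samples cl τ) * ((1 - κ * l) * (objective f Om x).toReal +
        κ * l * (objective f Om y).toReal) := by
    intro y hy
    obtain ⟨hzt, hz⟩ := hOm.strong_convex_segment hf.lipschitz_pos hμΩ hx hy hl0.le hl1
    have h1 := hf.sum_samples_le_of_le hnrm hs0 hτs hs hξs h𝒥 x (h x) (τ := τ)
    rw [← hβ, ← hκdef] at h1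
    have h2 := sum_samples_separableSum hOm hh hs0 hs hx (τ := τ)
    rw [← hκdef] at h2
    have h3 := hh.model_le hOm hf.lipschitz_pos hzt
    rw [inner_smul_right, wNorm_smul_sq nrm hf.lipschitz_pos] at h3
    have h4 := hf.strong_inner_gradient_le hμf x y
    rw [sum_congr rfl fun S _ => hOm.toReal_objective f (hh.separableSum_ne_top hOm hx S),
      sum_add_distrib, hOm.toReal_objective f hx, hOm.toReal_objective f hy, h2]
    refine (add_le_add_left h1 _).trans ?_
    rw [← mul_add]
    refine mul_le_mul_of_nonneg_left ?_ (by positivity)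
    have h5 := mul_le_mul_of_nonneg_left h4 hl0.le
    have h6 : β / 2 * (l ^ 2 * wNorm nrm L (y - x) ^ 2) =
        l * (μf / 2 * wNorm nrm L (y - x) ^ 2) +
        μΩ / 2 * (l * (1 - l)) * wNorm nrm L (y - x) ^ 2 := by
      linear_combination (l / 2 * wNorm nrm L (y - x) ^ 2) * hlβ
    have h7 : inner ℝ (gradient f x) (h x) + β / 2 * wNorm nrm L (h x) ^ 2 +
        ∑ i, (Om i (x i + h x i)).toReal ≤ l * (f y - f x) +
        ((1 - l) * (separableSum Om x).toReal + l * (separableSum Om y).toReal) := by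
      linarith
    have h8 := mul_le_mul_of_nonneg_left h7 hκ.le
    linarith
  -- The infimum need not be attained, so `y` is only nearly optimal, with a tolerance scaled to
  -- contribute at most `η`.
  have hinf : ∑ S ∈ samples cl τ, (objective f Om (x + ∑ i ∈ S, embed i (h x i))).toReal ≤
      #(samples cl τ) * ((1 - κ * l) * (objective f Om x).toReal + κ * l * Fstar) := by
    refine le_of_forall_pos_le_add fun η hη => ?_
    obtain ⟨y, hy, hyF⟩ := hOm.exists_toReal_objective_lt hFstar
      (show 0 < η / (#(samples cl τ) * (κ * l) + 1) by positivity)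
    refine (key y hy).trans ?_
    have h1 := mul_le_mul_of_nonneg_left hyF.le
      (show 0 ≤ #(samples cl τ) * (κ * l) by positivity)
    have h2 : #(samples cl τ) * (κ * l) * (η / (#(samples cl τ) * (κ * l) + 1)) ≤ η := by
      rw [← mul_div_assoc, div_le_iff₀ (by positivity)]
      linarith
    linarith
  rw [sum_sub_distrib, sum_const, nsmul_eq_mul]
  linarith

end OneStep

end DBCD

namespace DBCD

/-! ### From the partition and tuples of draws to classes and samples. -/

section Partition

open Finset

variable {n C s τ : ℕ} {P : Fin C → Finset (Fin n)} {cl : Fin n → Fin C}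

/-- A tuple of draws is recovered from its union by intersecting with the classes. -/
theorem sum_piFinset_powersetCard {M : Type*} [AddCommMonoid M]
    (hcl : ∀ i c, i ∈ P c ↔ cl i = c) (g : Finset (Fin n) → M) :
    ∑ z ∈ Fintype.piFinset (fun c => (P c).powersetCard τ), g (univ.biUnion z) =
      ∑ S ∈ samples cl τ, g S := by
  have key : ∀ z ∈ Fintype.piFinset (fun c => (P c).powersetCard τ), ∀ c,
      (univ.biUnion z).filter (cl · = c) = z c := by
    intro z hz c
    rw [Fintype.mem_piFinset] at hz
    ext i
    simp only [mem_filter, mem_biUnion, mem_univ, true_and]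
    constructor
    · rintro ⟨⟨c', hi⟩, rfl⟩
      rwa [(hcl i c').1 ((mem_powersetCard.1 (hz c')).1 hi)]
    · exact fun hi => ⟨⟨c, hi⟩, (hcl i c).1 ((mem_powersetCard.1 (hz c)).1 hi)⟩
  refine sum_bij' (fun z _ => univ.biUnion z) (fun S _ c => S.filter (cl · = c)) ?_ ?_ ?_ ?_ ?_
  · intro z hz
    rw [mem_samples]
    intro c
    rw [key z hz c]
    exact (mem_powersetCard.1 (Fintype.mem_piFinset.1 hz c)).2
  · intro S hS
    rw [Fintype.mem_piFinset]
    intro c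
    rw [mem_powersetCard]
    exact ⟨fun i hi => (hcl i c).2 (mem_filter.1 hi).2, mem_samples.1 hS c⟩
  · intro z hz
    exact funext (key z hz)
  · intro S _
    ext i
    simp
  · intro z _
    rfl

theorem sum_sum_eq_sum_biUnion {M : Type*} [AddCommMonoid M]
    (hP : ∀ c c', c ≠ c' → Disjoint (P c) (P c')) {z : Fin C → Finset (Fin n)}
    (hz : ∀ c, z c ⊆ P c) (v : Fin n → M) :
    ∑ c, ∑ i ∈ z c, v i = ∑ i ∈ univ.biUnion z, v i :=
  (sum_biUnion fun c _ c' _ h => disjoint_of_subset_left (hz c)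
    (disjoint_of_subset_right (hz c') (hP c c' h))).symm

theorem BalancedPartition.card_eq (hP : BalancedPartition P s) : n = C * s := by
  have h : univ.biUnion P = univ := by
    ext i
    simpa using hP.cover i
  have h1 := card_biUnion (s := univ) (t := P) fun c _ c' _ h => hP.disjoint c c' h
  rw [h, card_univ, Fintype.card_fin, sum_congr rfl fun c _ => hP.card c] at h1
  simpa using h1

theorem overlap_le (hP : BalancedPartition P s) (𝒥 : Finset (Finset (Fin n))) :
    overlap P 𝒥 ≤ s := by
  refine Finset.sup_le fun q _ => ?_
  rw [← hP.card q.1]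
  exact card_le_card inter_subset_left

theorem card_fibre_le_overlap (hcl : ∀ i c, i ∈ P c ↔ cl i = c) {𝒥 : Finset (Finset (Fin n))}
    {J : Finset (Fin n)} (hJ : J ∈ 𝒥) (c : Fin C) : #{i ∈ J | cl i = c} ≤ overlap P 𝒥 := by
  have h : {i ∈ J | cl i = c} = P c ∩ J := by
    ext i
    simp [hcl, and_comm]
  rw [h]
  exact le_sup (f := fun q : Fin C × Finset (Fin n) => #(P q.1 ∩ q.2)) (b := (c, J)) (by simp [hJ])

end Partition

/-! ### Randomness: uniform joint draws, independent of the past. -/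

section Sampling

open Finset

set_option linter.unusedSectionVars false

variable {Ω' : Type*} [MeasurableSpace Ω'] {Pr : Measure Ω'} [IsProbabilityMeasure Pr]
  {n C s τ : ℕ} {P : Fin C → Finset (Fin n)} {Z : ℕ → Fin C → Ω' → Finset (Fin n)}

/-- The probabilities of the `τ`-subsets already add up to one. -/
theorem DistributedSampling.ae_mem (hZ : DistributedSampling Pr P τ Z)
    (hP : ∀ c, τ ≤ #(P c)) : ∀ᵐ ω ∂Pr, ∀ k c, Z k c ω ∈ (P c).powersetCard τ := by
  rw [ae_all_iff]
  intro k
  rw [ae_all_iff]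
  intro c
  have hcard : (#((P c).powersetCard τ) : ℝ) ≠ 0 := by
    rw [card_powersetCard]
    exact_mod_cast (Nat.choose_pos (hP c)).ne'
  have e : {ω | Z k c ω ∈ (P c).powersetCard τ} =
      ⋃ S ∈ (P c).powersetCard τ, {ω | Z k c ω = S} := by
    ext ω
    simp
  have hm : MeasurableSet {ω | Z k c ω ∈ (P c).powersetCard τ} := by
    rw [e]
    exact measurableSet_biUnion _ fun S _ => hZ.measurable k c S
  have h1 : Pr.real {ω | Z k c ω ∈ (P c).powersetCard τ} = 1 := by
    rw [e, measureReal_biUnion_finset ?_ fun S _ => hZ.measurable k c S,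
      sum_congr rfl (hZ.uniform k c), sum_const, nsmul_eq_mul, mul_one_div_cancel hcard]
    intro S _ S' _ h
    exact Set.disjoint_left.2 fun ω h1 h2 => h (h1.symm.trans h2)
  refine (mem_ae_iff_prob_eq_one hm).2 ?_
  rwa [measureReal_def, ENNReal.toReal_eq_one_iff] at h1

theorem DistributedSampling.measureReal_eq (hZ : DistributedSampling Pr P τ Z) (k : ℕ)
    {z : Fin C → Finset (Fin n)} (hz : z ∈ Fintype.piFinset fun c => (P c).powersetCard τ) :
    Pr.real {ω | ∀ c, Z k c ω = z c} =
      1 / #(Fintype.piFinset fun c => (P c).powersetCard τ) := by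
  have h := hZ.indep.measure_inter_preimage_eq_mul ({k} ×ˢ univ)
    (sets := fun q : ℕ × Fin C => {z q.2}) (fun _ _ => MeasurableSpace.measurableSet_top)
  rw [Finset.prod_product, prod_singleton] at h
  have e : ⋂ i ∈ ({k} : Finset ℕ) ×ˢ (univ : Finset (Fin C)), (fun ω => Z i.1 i.2 ω) ⁻¹' {z i.2} =
      {ω | ∀ c, Z k c ω = z c} := by
    ext ω
    simp only [mem_product, mem_singleton, mem_univ, and_true, Set.mem_iInter, Set.mem_preimage,
      Set.mem_singleton_iff, Prod.forall]
    exact ⟨fun h c => h k c rfl, fun h k' c hk => hk ▸ h c⟩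
  have h' : Pr {ω | ∀ c, Z k c ω = z c} = ∏ c, Pr {ω | Z k c ω = z c} := by
    rw [← e]
    exact h
  rw [measureReal_def, h', ENNReal.toReal_prod, Fintype.card_piFinset]
  push_cast
  rw [one_div, ← prod_inv_distrib]
  refine prod_congr rfl fun c _ => ?_
  rw [← one_div]
  exact hZ.uniform k c _ (Fintype.mem_piFinset.1 hz c)

theorem iterate_congr {N : Fin n → ℕ} (h : BlockSpace N → BlockSpace N) (x₀ : BlockSpace N)
    {Z Z' : ℕ → Fin C → Finset (Fin n)} {k : ℕ} (hZ : ∀ j < k, Z j = Z' j) :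
    iterate h x₀ Z k = iterate h x₀ Z' k := by
  induction k with
  | zero => rfl
  | succ k ih =>
    rw [iterate, iterate, ih fun j hj => hZ j (hj.trans k.lt_succ_self), hZ k k.lt_succ_self]

/-- The indices of the choices made before iteration `k`. -/
def pastIndices (C k : ℕ) : Finset (ℕ × Fin C) := range k ×ˢ univ

/-- The iterate `k` as a function of the choices made before iteration `k`. -/
def iterateOfPast {N : Fin n → ℕ} (h : BlockSpace N → BlockSpace N) (x₀ : BlockSpace N)
    (k : ℕ) (t : pastIndices C k → Finset (Fin n)) : BlockSpace N :=
  -- The default `∅` is never read, because iterate `k` only uses draws with `j < k`.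
  iterate h x₀ (fun j c => if hjc : (j, c) ∈ pastIndices C k then t ⟨(j, c), hjc⟩ else ∅) k

theorem iterate_eq_iterateOfPast {N : Fin n → ℕ} (h : BlockSpace N → BlockSpace N)
    (x₀ : BlockSpace N) (Z : ℕ → Fin C → Ω' → Finset (Fin n)) (k : ℕ) (ω : Ω') :
    iterate h x₀ (fun j c => Z j c ω) k =
      iterateOfPast h x₀ k fun q : pastIndices C k => Z q.1.1 q.1.2 ω := by
  refine iterate_congr h x₀ fun j hj => funext fun c => ?_
  rw [dif_pos (by simp [pastIndices, hj])]

/-- Iterate `k` factors through the past draws, which live in a finite discrete space; hence neither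
`h` nor `ψ` has to be measurable. -/
theorem DistributedSampling.integrable_iterate (hZ : DistributedSampling Pr P τ Z)
    {N : Fin n → ℕ} (h : BlockSpace N → BlockSpace N) (x₀ : BlockSpace N) (k : ℕ)
    (ψ : BlockSpace N → ℝ) :
    Integrable (fun ω => ψ (iterate h x₀ (fun j c => Z j c ω) k)) Pr := by
  let _ : MeasurableSpace (Finset (Fin n)) := ⊤
  have hm (q : ℕ × Fin C) : Measurable (Z q.1 q.2) :=
    measurable_to_countable' fun S => hZ.measurable q.1 q.2 S
  simp only [iterate_eq_iterateOfPast]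
  have hX : Measurable fun ω (q : pastIndices C k) => Z q.1.1 q.1.2 ω :=
    measurable_pi_lambda _ fun q => hm q.1
  exact (integrable_map_measure (f := fun ω (q : pastIndices C k) => Z q.1.1 q.1.2 ω)
    (g := fun t => ψ (iterateOfPast h x₀ k t)) Measurable.of_discrete.aestronglyMeasurable
    hX.aemeasurable).1 Integrable.of_finite

theorem DistributedSampling.measurableSet_eq (hZ : DistributedSampling Pr P τ Z) (k : ℕ)
    (z : Fin C → Finset (Fin n)) : MeasurableSet {ω | ∀ c, Z k c ω = z c} := by
  have : {ω | ∀ c, Z k c ω = z c} = ⋂ c, {ω | Z k c ω = z c} := by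
    ext ω
    simp
  rw [this]
  exact MeasurableSet.iInter fun c => hZ.measurable k c _

/-- The choices made in iteration `k` are independent of iterate `k`. -/
theorem DistributedSampling.integral_iterate_mul (hZ : DistributedSampling Pr P τ Z)
    {N : Fin n → ℕ} (h : BlockSpace N → BlockSpace N) (x₀ : BlockSpace N) (k : ℕ)
    (ψ : BlockSpace N → ℝ) (z : Fin C → Finset (Fin n)) :
    ∫ ω, ψ (iterate h x₀ (fun j c => Z j c ω) k) *
        {ω | ∀ c, Z k c ω = z c}.indicator (fun _ => (1 : ℝ)) ω ∂Pr =
      (∫ ω, ψ (iterate h x₀ (fun j c => Z j c ω) k) ∂Pr) * Pr.real {ω | ∀ c, Z k c ω = z c} := by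
  let _ : MeasurableSpace (Finset (Fin n)) := ⊤
  have hm (q : ℕ × Fin C) : Measurable (Z q.1 q.2) :=
    measurable_to_countable' fun S => hZ.measurable q.1 q.2 S
  have hdisj : Disjoint (pastIndices C k) ({k} ×ˢ univ) := by
    rw [disjoint_left]
    rintro ⟨j, c⟩ h1 h2
    simp only [pastIndices, mem_product, mem_range, mem_univ, and_true, mem_singleton] at h1 h2
    omega
  have hind := hZ.indep.indepFun_finset (pastIndices C k) ({k} ×ˢ univ) hdisj hm
  let g : (({k} ×ˢ univ : Finset (ℕ × Fin C)) → Finset (Fin n)) → ℝ := fun t =>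
    {t : ({k} ×ˢ univ : Finset (ℕ × Fin C)) → Finset (Fin n) | ∀ q, t q = z q.1.2}.indicator
      (fun _ => 1) t
  have hg (ω : Ω') : g (fun q => Z q.1.1 q.1.2 ω) =
      {ω | ∀ c, Z k c ω = z c}.indicator (fun _ => (1 : ℝ)) ω := by
    have : (∀ q : ({k} ×ˢ univ : Finset (ℕ × Fin C)), Z q.1.1 q.1.2 ω = z q.1.2) ↔
        ∀ c, Z k c ω = z c := by
      constructor
      · intro h c
        exact h ⟨(k, c), by simp⟩
      · rintro h ⟨⟨j, c⟩, hq⟩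
        obtain rfl : k = j := by simpa using hq
        exact h c
    simp only [g, Set.indicator_apply]
    exact if_congr this rfl rfl
  have key := hind.integral_fun_comp_mul_comp
    (f := fun t => ψ (iterateOfPast h x₀ k t)) (g := g)
    (measurable_pi_lambda _ fun q : pastIndices C k => hm q.1).aemeasurable
    (measurable_pi_lambda _ fun q : ({k} ×ˢ univ : Finset (ℕ × Fin C)) => hm q.1).aemeasurable
    Measurable.of_discrete.aestronglyMeasurable Measurable.of_discrete.aestronglyMeasurable
  simp only [hg, ← iterate_eq_iterateOfPast] at key
  rw [key]
  congr 1
  exact integral_indicator_one (hZ.measurableSet_eq k z)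

/-- The expectation of a function of iterate `k + 1` in terms of iterate `k`. -/
theorem DistributedSampling.integral_iterate_succ (hZ : DistributedSampling Pr P τ Z)
    (hP : BalancedPartition P s) (hτs : τ ≤ s) {cl : Fin n → Fin C}
    (hcl : ∀ i c, i ∈ P c ↔ cl i = c)
    {N : Fin n → ℕ} (h : BlockSpace N → BlockSpace N) (x₀ : BlockSpace N) (k : ℕ)
    (ψ : BlockSpace N → ℝ) :
    ∫ ω, ψ (iterate h x₀ (fun j c => Z j c ω) (k + 1)) ∂Pr =
      ∫ ω, (#(samples cl τ) : ℝ)⁻¹ * ∑ S ∈ samples cl τ,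
        ψ (iterate h x₀ (fun j c => Z j c ω) k +
          ∑ i ∈ S, embed i (h (iterate h x₀ (fun j c => Z j c ω) k) i)) ∂Pr := by
  set A := Fintype.piFinset fun c => (P c).powersetCard τ with hA
  have hcard : (#A : ℝ) = #(samples cl τ) := by
    rw [hA, card_eq_sum_ones, card_eq_sum_ones, sum_piFinset_powersetCard hcl fun _ => 1]
  let Ψ : (Fin C → Finset (Fin n)) → BlockSpace N → ℝ := fun z x =>
    ψ (x + ∑ i ∈ univ.biUnion z, embed i (h x i))
  -- Decomposition by the value of the current draw: almost surely exactly one indicator equals one.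
  -- Independence then factors each term.
  have h1 : (fun ω => ψ (iterate h x₀ (fun j c => Z j c ω) (k + 1))) =ᵐ[Pr] fun ω =>
      ∑ z ∈ A, Ψ z (iterate h x₀ (fun j c => Z j c ω) k) *
        {ω | ∀ c, Z k c ω = z c}.indicator (fun _ => (1 : ℝ)) ω := by
    filter_upwards [hZ.ae_mem fun c => (hP.card c).symm ▸ hτs] with ω hω
    have hzA : (fun c => Z k c ω) ∈ A := Fintype.mem_piFinset.2 (hω k)
    rw [sum_eq_single_of_mem _ hzA]
    · simp only [Set.indicator_apply, Set.mem_ofPred_eq, implies_true, if_true, mul_one, Ψ, iterate]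
      rw [sum_sum_eq_sum_biUnion hP.disjoint fun c => (mem_powersetCard.1 (hω k c)).1]
    · intro z _ hz
      rw [Set.indicator_of_notMem, mul_zero]
      exact fun e => hz (funext e).symm
  rw [integral_congr_ae h1, integral_finsetSum, integral_const_mul, integral_finsetSum]
  · rw [mul_sum, ← sum_piFinset_powersetCard hcl]
    refine sum_congr rfl fun z hz => ?_
    rw [hZ.integral_iterate_mul h x₀ k (Ψ z) z, hZ.measureReal_eq k hz, ← hA, hcard, one_div,
      mul_comm]
  · exact fun S _ => hZ.integrable_iterate h x₀ k fun x => ψ (x + ∑ i ∈ S, embed i (h x i))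
  · intro z _
    have := (hZ.integrable_iterate h x₀ k (Ψ z)).indicator (hZ.measurableSet_eq k z)
    refine this.congr (Filter.Eventually.of_forall fun ω => ?_)
    simp only [Set.indicator_apply]
    split_ifs <;> simp

end Sampling

end DBCD

namespace DBCD

/-! ### Geometric decay of the expected gap, and Markov's inequality. -/

section Convergence

open Finset

variable {n C s τ : ℕ} {N : Fin n → ℕ} {P : Fin C → Finset (Fin n)}
  {Ω' : Type*} [MeasurableSpace Ω'] {Pr : Measure Ω'} [IsProbabilityMeasure Pr]
  {Z : ℕ → Fin C → Ω' → Finset (Fin n)} {nrm : (i : Fin n) → Seminorm ℝ (Block N i)}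
  {f : BlockSpace N → ℝ} {L : Fin n → ℝ} {Om : (i : Fin n) → Block N i → EReal}
  {β : ℝ} {h : BlockSpace N → BlockSpace N}

theorem ae_iterate_ne_top (hZ : DistributedSampling Pr P τ Z) (hP : BalancedPartition P s)
    (hτs : τ ≤ s) (hOm : Regularizer Om) (hh : IsUpdateMap nrm f Om β L h) {x₀ : BlockSpace N}
    (hx₀ : separableSum Om x₀ ≠ ⊤) :
    ∀ᵐ ω ∂Pr, ∀ k, separableSum Om (iterate h x₀ (fun j c => Z j c ω) k) ≠ ⊤ := by
  filter_upwards [hZ.ae_mem fun c => (hP.card c).symm ▸ hτs] with ω hω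
  intro k
  induction k with
  | zero => exact hx₀
  | succ k ih =>
    rw [iterate, sum_sum_eq_sum_biUnion hP.disjoint
      fun c => (mem_powersetCard.1 (hω k c)).1]
    exact hh.separableSum_ne_top hOm ih _

/-- If one iteration decreases the expected optimality gap by the factor `q`, then the expected
gap decays geometrically. -/
theorem integral_objective_iterate_le (hZ : DistributedSampling Pr P τ Z)
    (hP : BalancedPartition P s) (hτs : τ ≤ s) (hOm : Regularizer Om)
    (hh : IsUpdateMap nrm f Om β L h) {cl : Fin n → Fin C} (hcl : ∀ i c, i ∈ P c ↔ cl i = c)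
    {x₀ : BlockSpace N} (hx₀ : separableSum Om x₀ ≠ ⊤) {Fstar q : ℝ} (hq : 0 ≤ q)
    (hstep : ∀ x, separableSum Om x ≠ ⊤ →
      ∑ S ∈ samples cl τ, ((objective f Om (x + ∑ i ∈ S, embed i (h x i))).toReal - Fstar) ≤
        #(samples cl τ) * (q * ((objective f Om x).toReal - Fstar))) (k : ℕ) :
    ∫ ω, ((objective f Om (iterate h x₀ (fun j c => Z j c ω) k)).toReal - Fstar) ∂Pr ≤
      q ^ k * ((objective f Om x₀).toReal - Fstar) := by
  have hcard : 0 < (#(samples cl τ) : ℝ) := by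
    have e : #(samples cl τ) = #(Fintype.piFinset fun c => (P c).powersetCard τ) := by
      rw [card_eq_sum_ones, card_eq_sum_ones, sum_piFinset_powersetCard hcl fun _ => 1]
    rw [e, Fintype.card_piFinset]
    refine Nat.cast_pos.2 (prod_pos fun c _ => ?_)
    rw [card_powersetCard, hP.card]
    exact Nat.choose_pos hτs
  induction k with
  | zero => simp [iterate]
  | succ k ih =>
    rw [hZ.integral_iterate_succ hP hτs hcl h x₀ k fun x => (objective f Om x).toReal - Fstar]
    calc _ ≤ ∫ ω, q * ((objective f Om (iterate h x₀ (fun j c => Z j c ω) k)).toReal - Fstar) ∂Pr := by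
          refine integral_mono_ae (hZ.integrable_iterate h x₀ k fun x => (#(samples cl τ) : ℝ)⁻¹ *
            ∑ S ∈ samples cl τ, ((objective f Om (x + ∑ i ∈ S, embed i (h x i))).toReal - Fstar))
            ((hZ.integrable_iterate h x₀ k fun x =>
              q * ((objective f Om x).toReal - Fstar))) ?_
          filter_upwards [ae_iterate_ne_top hZ hP hτs hOm hh hx₀] with ω hω
          rw [inv_mul_le_iff₀ hcard]
          exact hstep _ (hω k)
      _ = q * ∫ ω, ((objective f Om (iterate h x₀ (fun j c => Z j c ω) k)).toReal - Fstar) ∂Pr :=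
          integral_const_mul _ _
      _ ≤ q * (q ^ k * ((objective f Om x₀).toReal - Fstar)) := mul_le_mul_of_nonneg_left ih hq
      _ = _ := by ring

/-- Markov's inequality for the optimality gap of an iterate. -/
theorem one_sub_le_measureReal_objective_iterate (hZ : DistributedSampling Pr P τ Z)
    (hP : BalancedPartition P s) (hτs : τ ≤ s) (hOm : Regularizer Om)
    (hh : IsUpdateMap nrm f Om β L h) {x₀ : BlockSpace N} (hx₀ : separableSum Om x₀ ≠ ⊤)
    {Fstar : ℝ} (hFstar : ⨅ x, objective f Om x = (Fstar : EReal)) {ε ρ : ℝ} (hε : 0 < ε) {k : ℕ}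
    (hk : ∫ ω, ((objective f Om (iterate h x₀ (fun j c => Z j c ω) k)).toReal - Fstar) ∂Pr
      ≤ ε * ρ) :
    1 - ρ ≤ Pr.real {ω | objective f Om (iterate h x₀ (fun j c => Z j c ω) k) - (Fstar : EReal)
      ≤ (ε : EReal)} := by
  set V : Ω' → ℝ := fun ω =>
    (objective f Om (iterate h x₀ (fun j c => Z j c ω) k)).toReal - Fstar with hV
  set E := {ω | objective f Om (iterate h x₀ (fun j c => Z j c ω) k) - (Fstar : EReal)
      ≤ (ε : EReal)}
  have hdom := ae_iterate_ne_top hZ hP hτs hOm hh hx₀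
  have h1 := mul_meas_ge_le_integral_of_nonneg (μ := Pr) (f := V)
    (by filter_upwards [hdom] with ω hω
        exact sub_nonneg.2 (hOm.le_toReal_objective hFstar (hω k)))
    (hZ.integrable_iterate h x₀ k fun x => (objective f Om x).toReal - Fstar) ε
  have h2 : Pr.real {ω | ε ≤ V ω} ≤ ρ := le_of_mul_le_mul_left (h1.trans hk) hε
  -- Covering the space and using subadditivity avoids having to show that `E` is measurable.
  have h3 : Pr.real (E ∪ {ω | ε ≤ V ω}) = 1 := by
    rw [measureReal_congr (t := Set.univ), probReal_univ]
    refine Filter.eventuallyEq_univ.2 ?_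
    filter_upwards [hdom] with ω hω
    rcases le_total (V ω) ε with hle | hle
    · left
      change objective f Om (iterate h x₀ (fun j c => Z j c ω) k) - (Fstar : EReal) ≤ (ε : EReal)
      rw [← EReal.coe_toReal ((objective_ne_top_iff f Om).2 (hω k)) (hOm.objective_ne_bot f _),
        ← EReal.coe_sub, EReal.coe_le_coe_iff]
      exact hle
    · exact Or.inr hle
  have h4 := measureReal_union_le (μ := Pr) E {ω | ε ≤ V ω}
  linarith

/-- From `q ≤ exp (-(1 - q))`, raised to the power `K`. -/
theorem pow_mul_le_of_log_le {q V c : ℝ} (hq0 : 0 ≤ q) (hV : 0 < V) (hc : 0 < c) {K : ℕ}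
    (hK : Real.log (V / c) ≤ (1 - q) * K) : q ^ K * V ≤ c := by
  have h1 : q ^ K ≤ Real.exp (-((1 - q) * K)) := by
    have h2 : q ≤ Real.exp (-(1 - q)) := by
      have := Real.add_one_le_exp (-(1 - q))
      linarith
    calc q ^ K ≤ Real.exp (-(1 - q)) ^ K := pow_le_pow_left₀ hq0 h2 K
      _ = _ := by
        rw [← Real.exp_nat_mul]
        congr 1
        ring
  have h3 : Real.exp (-((1 - q) * K)) ≤ Real.exp (-Real.log (V / c)) :=
    Real.exp_le_exp.2 (neg_le_neg hK)
  rw [Real.exp_neg (Real.log _), Real.exp_log (div_pos hV hc), inv_div] at h3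
  rw [← le_div_iff₀ hV]
  exact h1.trans h3

end Convergence

end DBCD

/-! ### The convergence theorem. -/

theorem theorem3
    {n C s τ : ℕ} {N : Fin n → ℕ}
    -- the norms on the blocks
    (nrm : (i : Fin n) → Seminorm ℝ (Block N i)) (hnrm : ∀ i t, nrm i t = 0 → t = 0)
    -- the problem
    (f : BlockSpace N → ℝ) (𝒥 : Finset (Finset (Fin n)))
    (fJ : Finset (Fin n) → BlockSpace N → ℝ) (L : Fin n → ℝ) (hf : SmoothPart nrm f 𝒥 fJ L)
    (Om : (i : Fin n) → Block N i → EReal) (hOm : Regularizer Om)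
    (Fstar : ℝ) (hFstar : ⨅ x, objective f Om x = (Fstar : EReal))
    -- the distributed sampling
    (P : Fin C → Finset (Fin n)) (hP : BalancedPartition P s) (hτ : 1 ≤ τ) (hτs : τ ≤ s)
    {Ω' : Type*} [MeasurableSpace Ω'] (Pr : Measure Ω') [IsProbabilityMeasure Pr]
    (Z : ℕ → Fin C → Ω' → Finset (Fin n)) (hZ : DistributedSampling Pr P τ Z)
    -- the method, with the step parameters `β` and `w = L`
    (β : ℝ) (hβ : β = stepParam C s τ (overlap P 𝒥))
    (h : BlockSpace N → BlockSpace N) (hh : IsUpdateMap nrm f Om β L h)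
    -- strong convexity
    (μf μΩ : ℝ) (hμf : StronglyConvexWith (wNorm nrm L) (fun x => (f x : EReal)) μf)
    (hμΩ : StronglyConvexWith (wNorm nrm L) (separableSum Om) μΩ) (hμ : 0 < μf + μΩ)
    -- the initial point, the confidence level, the accuracy and the number of iterations
    (x₀ : BlockSpace N) (hx₀ : objective f Om x₀ ≠ ⊤)
    (ρ : ℝ) (hρ0 : 0 < ρ) (hρ1 : ρ < 1)
    (ε : ℝ) (hε0 : 0 < ε) (hε : ε < (objective f Om x₀).toReal - Fstar)
    (K : ℕ) (hK : (n : ℝ) / ((C : ℝ) * (τ : ℝ)) * ((β + μΩ) / (μf + μΩ)) *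
      Real.log (((objective f Om x₀).toReal - Fstar) / (ε * ρ)) ≤ (K : ℝ)) :
    1 - ρ ≤ Pr.real {ω | objective f Om (iterate h x₀ (fun k c => Z k c ω) K) - (Fstar : EReal)
      ≤ (ε : EReal)} := by
  have hdom := (objective_ne_top_iff f Om).1 hx₀
  -- The bound `ε < F(x₀) - F*` yields a point with a smaller objective value than `x₀`.
  -- Nontriviality then rules out `C = 0` and allows a nonzero test direction for `μf ≤ β`.
  have hntr : Nontrivial (BlockSpace N) := by
    obtain ⟨y, -, hy⟩ := hOm.exists_toReal_objective_lt hFstar hε0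
    exact ⟨x₀, y, by rintro rfl; linarith⟩
  choose cl hcl' using hP.cover
  have hcl : ∀ i c, i ∈ P c ↔ cl i = c := fun i c => by
    refine ⟨fun hi => ?_, fun e => e ▸ hcl' i⟩
    by_contra hne
    exact Finset.disjoint_left.1 (hP.disjoint _ _ hne) (hcl' i) hi
  have hs : ∀ c, (Finset.univ.filter fun i => cl i = c).card = s := fun c => by
    rw [← hP.card c]
    congr 1
    ext i
    simp [hcl]
  have hC : 0 < C := by
    obtain ⟨v, hv⟩ := exists_ne (0 : BlockSpace N)
    refine Nat.pos_of_ne_zero ?_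
    rintro rfl
    exact hv (by ext i : 1; exact (cl i).elim0)
  have h𝒥 : ∀ J ∈ 𝒥, ∀ c, (J.filter fun i => cl i = c).card ≤ overlap P 𝒥 :=
    fun J hJ c => card_fibre_le_overlap hcl hJ c
  have hμβ : μf ≤ β := hβ ▸ hf.mu_le_stepParam hnrm hτ hτs h𝒥 hμf
  have hstep := fun x hx => sum_samples_objective_le hnrm hf hOm hFstar hτ hτs hs
    (overlap_le hP 𝒥) h𝒥 hβ hh hμf hμΩ hμ hμβ (x := x) hx
  have hτ0 : (0 : ℝ) < τ := by exact_mod_cast hτ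
  have hs0 : (0 : ℝ) < s := by exact_mod_cast lt_of_lt_of_le hτ hτs
  have hC0 : (0 : ℝ) < C := by exact_mod_cast hC
  have hβμ : 0 < β + μΩ := by linarith
  have hrate : 0 < (τ : ℝ) / s * ((μf + μΩ) / (β + μΩ)) := by positivity
  have hrate1 : (τ : ℝ) / s * ((μf + μΩ) / (β + μΩ)) ≤ 1 :=
    mul_le_one₀ ((div_le_one hs0).2 (by exact_mod_cast hτs)) (by positivity)
      ((div_le_one hβμ).2 (by linarith))
  -- As `n = C * s`, the factor in front of the logarithm is the reciprocal of the contraction rate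
  -- per step.
  have hinv : (n : ℝ) / ((C : ℝ) * (τ : ℝ)) * ((β + μΩ) / (μf + μΩ)) =
      ((τ : ℝ) / s * ((μf + μΩ) / (β + μΩ)))⁻¹ := by
    rw [hP.card_eq]
    push_cast
    field_simp
  rw [hinv, inv_mul_le_iff₀ hrate] at hK
  refine one_sub_le_measureReal_objective_iterate hZ hP hτs hOm hh hdom hFstar hε0
    ((integral_objective_iterate_le hZ hP hτs hOm hh hcl hdom (sub_nonneg.2 hrate1) hstep K).trans
      (pow_mul_le_of_log_le (sub_nonneg.2 hrate1) (hε0.trans hε) (mul_pos hε0 hρ0) ?_))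
  rwa [sub_sub_cancel]
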